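/- Let $K$ be an ideal triangulation, with finitely many tetrahedra and exactly one ideal vertex, of a 3-manifold $M$ (for instance of an oriented, finite-volume, one-cusped hyperbolic 3-manifold $M$). Let $N\subset M$ be a neighbourhood of the cusp which meets each tetrahedron of $K$ in four punctured neighbourhoods of its vertices, let $*\in N$ be the base point of $M$, let $\widetilde M\to M$ be the universal cover with a base point $\tilde *$ over $*$, so that $\pi_1(M)=\pi_1(M,*)$ acts on $\widetilde M$ by deck transformations, and let $\widetilde N$ be the component of the preimage of $N$ containing $\tilde *$. Identify oriented lines in $\mathbb H^3$ with the traceless matrices $l\in \mathrm{SL}_2\mathbb C$ (on which $\mathrm{PSL}_2\mathbb C$ acts by conjugation); $\cosh$ of the complex distance of two oriented lines $l,m$ is $\langle l,m\rangle=-\frac12\mathrm{tr}(lm)$. For a homomorphism $\rho:\pi_1(M)\to\mathrm{PSL}_2\mathbb C$ and an oriented line $\sigma$ preserved by $\rho(\pi_1(N))$, say that $\rho$ has ortholengths $p=(p_e)_e$ along $\sigma$ if for every edge $e$ of $K$ and every lift of $e$ to $\widetilde M$, with ends in $\gamma_1\widetilde N$ and $\gamma_2\widetilde N$, we have $\langle\rho(\gamma_1)\sigma,\rho(\gamma_2)\sigma\rangle=p_e$.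 The invariant $\mathit{Orth}_K(\rho)$ is defined if $\rho(\pi_1(N))$ fixes exactly two points of the sphere at infinity; then $\mathit{Orth}_K(\rho)=p$ means that $\rho$ has ortholengths $p$ along $\sigma$, where $\sigma$ is the line joining these two points, with either orientation. Let $\mathcal P(K)$ be the set of vectors $p$ of complex numbers indexed by the edges of $K$ such that, for each tetrahedron of $K$, $\det(x_{ij})_{1\le i,j\le 4}=0$, where $x_{ii}=1$ and $x_{ij}$ is the parameter of the edge between the vertices $i\ne j$. Let $\mathcal T\subset\mathcal P(K)$ be the set of those $p$ with $p_e=\pm1$ for some $e$. Let $\mathcal S\subset\mathcal P(K)$ be the set of those $p$ for which there are two distinct faces of $K$, each with edge parameters $a,b,c$ satisfying $\det\begin{pmatrix}1&a&b\\a&1&c\\b&c&1\end{pmatrix}=0$. A coherent realisation of $p\in\mathcal P(K)\setminus\mathcal T$ assigns to each corner of each tetrahedron of $K$ an oriented line, such that $\langle l_i,l_j\rangle=x_{ij}$ for the four lines of each tetrahedron, and such that for each face of $K$ the two triples of lines given by the two adjacent tetrahedra differ by an element of $\mathrm{PSL}_2\mathbb C$ (respecting the corners). Lemma. Let $p\in\mathcal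 P(K)\setminus\mathcal T$. (1) For each coherent realisation $H$ of $p$ there are a representation $\rho:\pi_1(M)\to\mathrm{PSL}_2\mathbb C$ and an oriented line $\sigma$, preserved by $\rho(\pi_1(N))$, such that $\rho$ has ortholengths $p$ along $\sigma$, and such that for every lift to $\widetilde M$ of a tetrahedron $\triangle$ of $K$, with corners in $\gamma_1\widetilde N,\dots,\gamma_4\widetilde N$, the lines $\rho(\gamma_1)\sigma,\dots,\rho(\gamma_4)\sigma$ are the image of the hextet $H_\triangle$ under an element of $\mathrm{PSL}_2\mathbb C$. If $\rho$ is not trivial on $\pi_1(N)$, then $\mathit{Orth}_K(\rho)$ is defined and equal to $p$. (2) Up to conjugacy there are only finitely many representations $\rho$ which have ortholengths $p$ along some oriented line preserved by $\rho(\pi_1(N))$; in particular, there are only finitely many with $\mathit{Orth}_K(\rho)=p$. (3) If $p\notin\mathcal S$, then any two representations as in (2) are conjugate. So if moreover $p$ has a coherent realisation, then up to conjugacy there is exactly one such $\rho$. -/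

import Mathlib

open scoped MatrixGroups

/-- An oriented line in hyperbolic 3-space, given by its normalised line matrix: a traceless matrix
in `SL(2, ℂ)`.  Its two eigenlines, ordered by their eigenvalues `-i` and `i`, are the ordered
end-points of the line on the sphere at infinity `ℂP¹`. -/
def OrientedLine : Type := {l : SL(2, ℂ) // (l : Matrix (Fin 2) (Fin 2) ℂ).trace = 0}

namespace OrientedLine

/-- `SL(2, ℂ)` acts on oriented lines by conjugation. -/
instance instMulActionSL : MulAction SL(2, ℂ) OrientedLine where
  smul g l := ⟨g * l.1 * g⁻¹, by
    rw [Matrix.SpecialLinearGroup.coe_mul, Matrix.trace_mul_comm,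
      ← Matrix.SpecialLinearGroup.coe_mul, ← mul_assoc, inv_mul_cancel, one_mul]
    exact l.2⟩
  one_smul l := Subtype.ext (by change 1 * l.1 * 1⁻¹ = l.1; group)
  mul_smul g h l := Subtype.ext (by
    change g * h * l.1 * (g * h)⁻¹ = g * (h * l.1 * h⁻¹) * g⁻¹; group)

/-- `PSL(2, ℂ)`, the group of orientation-preserving isometries of hyperbolic 3-space, acts on
oriented lines by conjugation with either of the two covering matrices. -/
def pslHom : PSL(2, ℂ) →* Equiv.Perm OrientedLine :=
  QuotientGroup.lift (Subgroup.center SL(2, ℂ)) (MulAction.toPermHom SL(2, ℂ) OrientedLine)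
    fun g hg => by
      ext1 l
      apply Subtype.ext
      change g * l.1 * g⁻¹ = l.1
      rw [← Subgroup.mem_center_iff.mp hg l.1, mul_assoc, mul_inv_cancel, mul_one]

instance instMulActionPSL : MulAction PSL(2, ℂ) OrientedLine :=
  MulAction.compHom OrientedLine pslHom

/-- `cosh` of the complex distance between two oriented lines, `-tr(l m) / 2`. -/
noncomputable def coshDist (l m : OrientedLine) : ℂ :=
  -(1 / 2) * (l.1.1 * m.1.1).trace

end OrientedLine

/-- A (topological) ideal triangulation, given as a set `T` of tetrahedra, each with vertices
`0, 1, 2, 3`, and a pairing of their faces; face `f` of a tetrahedron is the one opposite to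
vertex `f`.  Face `f` of `t` is glued to a face of the tetrahedron `adj t f`, and `glue t f` is the
permutation which takes the vertices of face `f` of `t` to the vertices of `adj t f` with which they
are identified, and which takes `f` to the label of the face it is glued to. -/
structure IdealTriangulation (T : Type*) where
  adj : T → Fin 4 → T
  glue : T → Fin 4 → Equiv.Perm (Fin 4)
  adj_adj : ∀ t f, adj (adj t f) (glue t f f) = t
  glue_adj : ∀ t f, glue (adj t f) (glue t f f) = (glue t f)⁻¹
  /-- no face is glued to itself -/
  face_ne : ∀ t f, (adj t f, glue t f f) ≠ (t, f)
  /-- no edge is identified with its own reverse (otherwise the space is not a manifold) -/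
  edge_not_reversed : ∀ (t : T) (a b : Fin 4), a ≠ b →
    ¬ Relation.EqvGen
      (fun e e' : T × Fin 4 × Fin 4 => ∃ f, f ≠ e.2.1 ∧ f ≠ e.2.2 ∧
        e' = (adj e.1 f, glue e.1 f e.2.1, glue e.1 f e.2.2))
      (t, a, b) (t, b, a)

/-- A tetrahedron with its four vertices removed, in barycentric coordinates. -/
def IdealTetrahedron : Type :=
  {x : Fin 4 → ℝ // (∀ i, 0 ≤ x i) ∧ ∑ i, x i = 1 ∧ ∀ i, x i ≠ 1}

instance : TopologicalSpace IdealTetrahedron := instTopologicalSpaceSubtype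

namespace IdealTriangulation

variable {T : Type*} (K : IdealTriangulation T)

/-- The identification of a point of face `f` of `t` with a point of `adj t f`. -/
def GlueRel (x y : (_ : T) × IdealTetrahedron) : Prop :=
  ∃ f, x.2.1 f = 0 ∧ y.1 = K.adj x.1 f ∧ ∀ i, y.2.1 (K.glue x.1 f i) = x.2.1 i

/-- The 3-manifold `M` triangulated by `K`: the disjoint union of the ideal tetrahedra modulo the
face identifications, with the quotient topology. -/
def Space : Type _ := Quot K.GlueRel

instance : TopologicalSpace K.Space :=
  inferInstanceAs (TopologicalSpace (Quot K.GlueRel))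

/-- The map from the tetrahedron `t` to `M`. -/
def chart (t : T) : C(IdealTetrahedron, K.Space) where
  toFun x := Quot.mk _ ⟨t, x⟩
  continuous_toFun := continuous_quot_mk.comp continuous_sigmaMk

/-- Two corners of tetrahedra (that is, pairs `(t, v)` with `v` a vertex of `t`) are adjacent if
they are identified by a face gluing. -/
def CornerRel (c c' : T × Fin 4) : Prop :=
  ∃ f, f ≠ c.2 ∧ c' = (K.adj c.1 f, K.glue c.1 f c.2)

/-- `K` has a single ideal vertex, i.e. `M` has exactly one cusp. -/
def OneCusped : Prop := ∀ c c' : T × Fin 4, Relation.EqvGen K.CornerRel c c'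

/-- The neighbourhood `N` of the cusp; it meets each tetrahedron in four punctured neighbourhoods
of its vertices. -/
def cusp : Set K.Space :=
  {m | ∃ (t : T) (x : IdealTetrahedron) (v : Fin 4), 3 / 4 ≤ x.1 v ∧ m = K.chart t x}

/-! ### Ortholength parameters -/

/-- Two edges of tetrahedra (a tetrahedron with an ordered pair of distinct vertices) are related if
they are reverses of each other or are identified by a face gluing. -/
def EdgeRel (e e' : T × {ab : Fin 4 × Fin 4 // ab.1 ≠ ab.2}) : Prop :=
  (e'.1 = e.1 ∧ e'.2.1 = (e.2.1.2, e.2.1.1)) ∨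
  ∃ f, f ≠ e.2.1.1 ∧ f ≠ e.2.1.2 ∧ e'.1 = K.adj e.1 f ∧
    e'.2.1 = (K.glue e.1 f e.2.1.1, K.glue e.1 f e.2.1.2)

/-- The set of (unoriented) edges of `K`. -/
def Edge : Type _ := Quot K.EdgeRel

/-- The edge of `K` between the distinct vertices `a` and `b` of `t`. -/
def edge (t : T) (a b : Fin 4) (h : a ≠ b) : K.Edge := Quot.mk _ (t, ⟨(a, b), h⟩)

/-- The symmetric `4 × 4` matrix `(x_{ij})` of the parameters `p` on the edges of the tetrahedron
`t`, with diagonal entries `1`. -/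
def hextetMatrix (p : K.Edge → ℂ) (t : T) : Matrix (Fin 4) (Fin 4) ℂ :=
  Matrix.of fun i j => if h : i = j then 1 else p (K.edge t i j h)

/-- The ortholength space `𝒫(K)`. -/
def ortholengthSpace : Set (K.Edge → ℂ) := {p | ∀ t, (K.hextetMatrix p t).det = 0}

/-- The subset `𝒯` of `𝒫(K)`. -/
def setT : Set (K.Edge → ℂ) := {p | p ∈ K.ortholengthSpace ∧ ∃ e, p e = 1 ∨ p e = -1}

/-- The determinant of the `3 × 3` matrix of the parameters `p` on the edges of the face `f` of `t`
(delete row and column `f`). -/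
noncomputable def faceDet (p : K.Edge → ℂ) (t : T) (f : Fin 4) : ℂ :=
  ((K.hextetMatrix p t).submatrix f.succAbove f.succAbove).det

/-- The subset `𝒮` of `𝒫(K)`: the face determinants of two distinct faces of `K` vanish. -/
def setS : Set (K.Edge → ℂ) :=
  {p | p ∈ K.ortholengthSpace ∧ ∃ (t t' : T) (f f' : Fin 4),
    (t', f') ≠ (t, f) ∧ (t', f') ≠ (K.adj t f, K.glue t f f) ∧
    K.faceDet p t f = 0 ∧ K.faceDet p t' f' = 0}

/-! ### Realisations by hextets -/

/-- `H` assigns an oriented line to each corner of each tetrahedron; it is a realisation of `p` if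
`cosh` of the complex distance between any two lines of a tetrahedron is the parameter of the edge
between the two vertices. -/
def IsRealisation (p : K.Edge → ℂ) (H : T → Fin 4 → OrientedLine) : Prop :=
  ∀ (t : T) (i j : Fin 4) (h : i ≠ j), (H t i).coshDist (H t j) = p (K.edge t i j h)

/-- A coherent realisation: for each face, the right-angled hexagons coming from the two adjacent
tetrahedra are isometric by an orientation-preserving isometry matching the corners. -/
def IsCoherentRealisation (p : K.Edge → ℂ) (H : T → Fin 4 → OrientedLine) : Prop :=
  K.IsRealisation p H ∧
  ∀ (t : T) (f : Fin 4), ∃ g : PSL(2, ℂ), ∀ v, v ≠ f →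
    g • H t v = H (K.adj t f) (K.glue t f v)

/-! ### The ortholength invariant

In Mathlib's fundamental group the product `γ * δ` is the class of `δ` followed by `γ`.  With this
convention, a path `d` from a point of the tetrahedron `t` to the base point determines a lift of
`t` to the universal cover, and `cornerLoops` below gives the elements of `π₁(M)` which carry the
base component of the preimage of `N` to the component at the vertex `v` of that lift. -/

variable {K}

/-- The peripheral elements: the image of `π₁(N, b)` in `π₁(M, b)`. -/
def peripheral (b : K.Space) : Set (FundamentalGroup K.Space b) :=
  {γ | ∃ c : Path b b, (∀ s, c s ∈ K.cusp) ∧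
    γ = FundamentalGroup.fromPath (Path.Homotopic.Quotient.mk c)}

/-- The classes of the loops which start at the base point `b`, run inside `N` to a point close to
the vertex `v` of `t`, then inside `t` to the point `y`, and then back to `b` along `d`. -/
def cornerLoops {b : K.Space} (t : T) (y : IdealTetrahedron) (d : Path (K.chart t y) b)
    (v : Fin 4) : Set (FundamentalGroup K.Space b) :=
  {γ | ∃ (z : IdealTetrahedron) (n : Path b (K.chart t z)) (c : Path z y),
    3 / 4 ≤ z.1 v ∧ (∀ s, n s ∈ K.cusp) ∧
    γ = FundamentalGroup.fromPath (Path.Homotopic.Quotient.mk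
      ((n.trans (c.map (K.chart t).continuous)).trans d))}

/-- The oriented line `σ` is preserved by `ρ(π₁(N))`, and measured from `σ` the hyperbolic cosines
of the ortholengths of `ρ` are `p`: if a lift of an edge of `K` joins the translates by `γ₁` and `γ₂`
of the base component of the preimage of `N`, then `cosh` of the complex distance between
`ρ(γ₁) • σ` and `ρ(γ₂) • σ` is the parameter of that edge. -/
def HasOrtholengthsAlong {b : K.Space} (ρ : FundamentalGroup K.Space b →* PSL(2, ℂ))
    (σ : OrientedLine) (p : K.Edge → ℂ) : Prop :=
  (∀ γ ∈ peripheral b, ρ γ • σ = σ) ∧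
  ∀ (t : T) (i j : Fin 4) (h : i ≠ j) (y : IdealTetrahedron) (d : Path (K.chart t y) b),
    ∀ γ₁ ∈ cornerLoops t y d i, ∀ γ₂ ∈ cornerLoops t y d j,
      (ρ γ₁ • σ).coshDist (ρ γ₂ • σ) = p (K.edge t i j h)

/-- The domain of `Orth_K`: `ρ(π₁(N))` fixes exactly two points on the sphere at infinity. -/
def OrthDefined {b : K.Space} (ρ : FundamentalGroup K.Space b →* PSL(2, ℂ)) : Prop :=
  {x : Projectivization ℂ (Fin 2 → ℂ) | ∀ γ ∈ peripheral b, ρ γ • x = x}.ncard = 2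

/-- `Orth_K(ρ)` is defined and equal to `p`.  (The line `σ` is then unique up to orientation.) -/
def OrthEq {b : K.Space} (ρ : FundamentalGroup K.Space b →* PSL(2, ℂ)) (p : K.Edge → ℂ) : Prop :=
  OrthDefined ρ ∧ ∃ σ : OrientedLine, HasOrtholengthsAlong ρ σ p

/-- `ρ` and `σ` induce the realisation `H`, up to isometry of the individual hextets: for every lift
of a tetrahedron `t`, the lines `ρ(γ_v) • σ` at its four corners form a hextet isometric to `H t`. -/
def Induces {b : K.Space} (ρ : FundamentalGroup K.Space b →* PSL(2, ℂ)) (σ : OrientedLine)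
    (H : T → Fin 4 → OrientedLine) : Prop :=
  ∀ (t : T) (y : IdealTetrahedron) (d : Path (K.chart t y) b), ∃ g : PSL(2, ℂ),
    ∀ (v : Fin 4), ∀ γ ∈ cornerLoops t y d v, ρ γ • σ = g • H t v

/-- Two representations are conjugate. -/
def RepConj {b : K.Space} (ρ ρ' : FundamentalGroup K.Space b →* PSL(2, ℂ)) : Prop :=
  ∃ g : PSL(2, ℂ), ∀ γ, ρ' γ = g * ρ γ * g⁻¹

end IdealTriangulation

/-!
Oriented lines are vectors of norm `1` in the 3-dimensional quadratic space of traceless matrices,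
on which `PSL(2, ℂ)` acts as the special orthogonal group. Two lines `l`, `m` with `⟨l, m⟩ ≠ ±1`
can be moved into a normal position which depends only on `⟨l, m⟩`, by a unique element of
`PSL(2, ℂ)` (`OrientedLine.exists_normalForm`, `OrientedLine.eq_of_smul_eq`). A third line `x` is
determined by its products with `l` and `m` and the triple invariant `tr(l m x)`, whose square is
four times the Gram determinant, so that the products leave only a choice of sign. For `p ∉ 𝒯` all
pairs of lines of a hextet are of this kind.

*Existence.* In a coherent realisation the isometry `g t f` across each face is unique, because it
is prescribed on three lines. Around an edge of `K` the product of these isometries fixes the two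
lines at the ends of the edge, hence is trivial. So the hextets define a flat `PSL(2, ℂ)`-bundle
on `M`. Concretely, the hextets around a cell of `K` are trivialised by moving the lines at two
vertices of this cell into normal position. The order of the two vertices has to be chosen
consistently, which is possible because no edge is identified with its own reverse and no face is
glued to itself (`exists_orientation`). The transition functions between these frames on the stars
of the cells are locally constant, and the monodromy of the associated covering space is the
holonomy (`exists_holonomy`, `exists_developing`). The line at a corner of a developed hextet is
constant along paths in `N`, so the line `σ` at the base point is preserved by `π₁(N)`, and the
representation induces the given realisation. A nontrivial group of isometries which preserve an
oriented line fixes exactly its end-points (`OrientedLine.ncard_fixed_eq_two`).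

*Finiteness and uniqueness.* Conversely, `(ρ, σ)` with ortholengths `p` induces a coherent
realisation `H` (`exists_induces`), and `ρ` is determined up to conjugacy by the hextets `H t` up
to isometry (`repConj_of_carries`): the isometries between the lines given by `(ρ, σ)` and
`(ρ', σ')` at the corners of a lifted tetrahedron agree for any two lifts with a common face, and
all lifts are connected through faces. The last point is proved by showing that every path in `M` is
homotopic to a finite concatenation of paths inside tetrahedra (`chartGenerated`). A hextet is
determined up to isometry by `p` and the triple invariants of two of its faces, which leaves
finitely many possibilities. If the determinant of a face is not zero, then the triple invariant
of this face alone determines the hextets on both of its sides. If there is at most one degenerate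
face, then the remaining faces still connect all tetrahedra, as the dual graph is 4-regular and so
has no bridge (`eq_univ_of_unique_exit`). Hence two realisations agree up to one global sign;
changing this sign reverses all lines, which amounts to replacing `σ` by `-σ` with the same `ρ`.
-/

/-! ### Oriented lines and the action of `PSL(2, ℂ)` -/

namespace OrientedLine

lemma exists_entries (l : OrientedLine) :
    ∃ a b c : ℂ, l.1.1 = !![a, b; c, -a] ∧ a * a + b * c = -1 := by
  have ht := l.2
  have hd := l.1.2
  rw [Matrix.trace_fin_two] at ht
  rw [Matrix.det_fin_two] at hd
  have h : l.1.1 1 1 = -l.1.1 0 0 := by linear_combination ht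
  refine ⟨l.1.1 0 0, l.1.1 0 1, l.1.1 1 0, ?_, ?_⟩
  · rw [← h]
    exact Matrix.eta_fin_two _
  · rw [h] at hd
    linear_combination -hd

lemma ext_matrix {l m : OrientedLine} (h : l.1.1 = m.1.1) : l = m :=
  Subtype.ext (Subtype.ext h)

/-- The oriented line with the given entries. -/
def ofEntries (a b c : ℂ) (h : a * a + b * c = -1) : OrientedLine :=
  ⟨⟨!![a, b; c, -a], by rw [Matrix.det_fin_two_of]; linear_combination -h⟩, by
    simp [Matrix.trace_fin_two]⟩

/-- The triple invariant `tr(l m n)`; up to a constant factor it is the determinant of the three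
vectors `l`, `m`, `n` in the 3-dimensional quadratic space of traceless matrices. -/
def triple (l m n : OrientedLine) : ℂ := (l.1.1 * m.1.1 * n.1.1).trace

lemma coe_smul_SL (g : SL(2, ℂ)) (l : OrientedLine) : (g • l).1 = g * l.1 * g⁻¹ := rfl

lemma mk_smul (g : SL(2, ℂ)) (l : OrientedLine) :
    (QuotientGroup.mk g : PSL(2, ℂ)) • l = g • l := rfl

lemma coshDist_smul (g : PSL(2, ℂ)) (l m : OrientedLine) :
    (g • l).coshDist (g • m) = l.coshDist m := by
  induction g using QuotientGroup.induction_on with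
  | H g =>
    have h : (g • l).1 * (g • m).1 = g * (l.1 * m.1) * g⁻¹ := by
      simp only [coe_smul_SL]; group
    have h2 := congrArg (fun A : SL(2, ℂ) => (A.1).trace) h
    simp only [Matrix.SpecialLinearGroup.coe_mul] at h2
    simp only [mk_smul, coshDist]
    rw [h2, Matrix.trace_mul_comm, ← mul_assoc, ← Matrix.SpecialLinearGroup.coe_mul,
      inv_mul_cancel, Matrix.SpecialLinearGroup.coe_one, one_mul]

lemma triple_smul (g : PSL(2, ℂ)) (l m n : OrientedLine) :
    (g • l).triple (g • m) (g • n) = l.triple m n := by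
  induction g using QuotientGroup.induction_on with
  | H g =>
    have h : (g • l).1 * (g • m).1 * (g • n).1 = g * (l.1 * m.1 * n.1) * g⁻¹ := by
      simp only [coe_smul_SL]; group
    have h2 := congrArg (fun A : SL(2, ℂ) => (A.1).trace) h
    simp only [Matrix.SpecialLinearGroup.coe_mul] at h2
    simp only [mk_smul, triple]
    rw [h2, Matrix.trace_mul_comm, ← mul_assoc, ← Matrix.SpecialLinearGroup.coe_mul,
      inv_mul_cancel, Matrix.SpecialLinearGroup.coe_one, one_mul]

lemma coshDist_comm (l m : OrientedLine) : l.coshDist m = m.coshDist l := by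
  rw [coshDist, coshDist, Matrix.trace_mul_comm]

lemma coshDist_self (l : OrientedLine) : l.coshDist l = 1 := by
  obtain ⟨a, b, c, h, e⟩ := l.exists_entries
  simp only [coshDist, h, Matrix.trace_fin_two, Matrix.mul_apply, Fin.sum_univ_two]
  simp
  linear_combination -e

/-- The square of the triple invariant is, up to a factor, the Gram determinant. -/
lemma triple_sq (l m n : OrientedLine) :
    l.triple m n ^ 2 = 4 * (1 + 2 * l.coshDist m * m.coshDist n * l.coshDist n
      - l.coshDist m ^ 2 - m.coshDist n ^ 2 - l.coshDist n ^ 2) := by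
  obtain ⟨a, b, c, h, e⟩ := l.exists_entries
  obtain ⟨a', b', c', h', e'⟩ := m.exists_entries
  obtain ⟨a'', b'', c'', h'', e''⟩ := n.exists_entries
  simp only [triple, coshDist, h, h', h'', Matrix.trace_fin_two, Matrix.mul_apply, Fin.sum_univ_two]
  simp
  -- the Gram determinant is homogenised by replacing each `1` with `-(a * a + b * c)`
  linear_combination (-4) * (1 - (a' * a'' + (b' * c'' + c' * b'') / 2) ^ 2) * e +
    (-4) * (-(a * a + b * c) - (a * a'' + (b * c'' + c * b'') / 2) ^ 2) * e' +
    (-4) * ((a * a + b * c) * (a' * a' + b' * c') - (a * a' + (b * c' + c * b') / 2) ^ 2) * e''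

/-- Expansion of a traceless matrix in the basis `l`, `m`, `l m - m l`. -/
lemma expansion (l m x : OrientedLine) :
    (1 - l.coshDist m ^ 2) • x.1.1 =
      (l.coshDist x - l.coshDist m * m.coshDist x) • l.1.1 +
      (m.coshDist x - l.coshDist m * l.coshDist x) • m.1.1 -
      (1 / 4 * l.triple m x) • (l.1.1 * m.1.1 - m.1.1 * l.1.1) := by
  obtain ⟨a, b, c, h, e⟩ := l.exists_entries
  obtain ⟨a', b', c', h', e'⟩ := m.exists_entries
  obtain ⟨a'', b'', c'', h'', e''⟩ := x.exists_entries
  simp only [triple, coshDist, h, h', h'', Matrix.trace_fin_two, Matrix.mul_apply, Fin.sum_univ_two]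
  ext i j
  -- as in `triple_sq`, each `1` is homogenised to `-(a * a + b * c)`
  fin_cases i <;> fin_cases j <;> simp
  · linear_combination
      (a'' + (a' * a'' + (b' * c'' + c' * b'') / 2) * a') * e +
      (-(a * a + b * c) * a'' + (a * a'' + (b * c'' + c * b'') / 2) * a) * e'
  · linear_combination
      (b'' + (a' * a'' + (b' * c'' + c' * b'') / 2) * b') * e +
      (-(a * a + b * c) * b'' + (a * a'' + (b * c'' + c * b'') / 2) * b) * e'
  · linear_combination
      (c'' + (a' * a'' + (b' * c'' + c' * b'') / 2) * c') * e +
      (-(a * a + b * c) * c'' + (a * a'' + (b * c'' + c * b'') / 2) * c) * e'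
  · linear_combination
      -(a'' + (a' * a'' + (b' * c'' + c' * b'') / 2) * a') * e -
      (-(a * a + b * c) * a'' + (a * a'' + (b * c'' + c * b'') / 2) * a) * e'

/-- A line is determined by its position relative to two lines without a common end-point. -/
lemma eq_of_coshDist_of_triple {l m x y : OrientedLine} (hlm : l.coshDist m ^ 2 ≠ 1)
    (hl : l.coshDist x = l.coshDist y) (hm : m.coshDist x = m.coshDist y)
    (ht : l.triple m x = l.triple m y) : x = y := by
  have h1 := expansion l m x
  rw [hl, hm, ht, ← expansion l m y] at h1
  exact ext_matrix (smul_right_injective _ (sub_ne_zero.2 (Ne.symm hlm)) h1)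

/-- A line is determined by its distances to three lines whose matrices are linearly independent. -/
lemma eq_of_coshDist_of_triple_ne_zero {l m n x y : OrientedLine} (h : l.triple m n ≠ 0)
    (hl : l.coshDist x = l.coshDist y) (hm : m.coshDist x = m.coshDist y)
    (hn : n.coshDist x = n.coshDist y) : x = y := by
  have key : ∀ x : OrientedLine, l.triple m n • x.1.1 =
      -(l.coshDist x • (m.1.1 * n.1.1 - n.1.1 * m.1.1) +
        m.coshDist x • (n.1.1 * l.1.1 - l.1.1 * n.1.1) +
        n.coshDist x • (l.1.1 * m.1.1 - m.1.1 * l.1.1)) := fun x => by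
    obtain ⟨a, b, c, h, -⟩ := l.exists_entries
    obtain ⟨a', b', c', h', -⟩ := m.exists_entries
    obtain ⟨a'', b'', c'', h'', -⟩ := n.exists_entries
    obtain ⟨a₃, b₃, c₃, h₃, -⟩ := x.exists_entries
    simp only [triple, coshDist, h, h', h'', h₃, Matrix.trace_fin_two, Matrix.mul_apply,
      Fin.sum_univ_two]
    ext i j
    fin_cases i <;> fin_cases j <;> simp <;> ring
  have hxy := key x
  rw [hl, hm, hn, ← key y] at hxy
  exact ext_matrix (smul_right_injective _ h hxy)

/-- `PSL(2, ℂ)` acts faithfully on oriented lines. -/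
lemma eq_one_of_forall_smul_eq {g : PSL(2, ℂ)} (h : ∀ l : OrientedLine, g • l = l) : g = 1 := by
  induction g using QuotientGroup.induction_on with
  | H g =>
    have key : ∀ l : OrientedLine, g * l.1 = l.1 * g := fun l => by
      have := congrArg Subtype.val (h l)
      rw [mk_smul, coe_smul_SL] at this
      exact mul_inv_eq_iff_eq_mul.1 this
    have h1 : g.1 * !![Complex.I, 0; 0, -Complex.I] = !![Complex.I, 0; 0, -Complex.I] * g.1 :=
      congrArg Subtype.val (key (ofEntries Complex.I 0 0 (by simp)))
    have h2 : g.1 * !![0, 1; -1, -0] = !![0, 1; -1, -0] * g.1 :=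
      congrArg Subtype.val (key (ofEntries 0 1 (-1) (by simp)))
    have hI := Complex.I_ne_zero
    have e01 := congrFun (congrFun h1 0) 1
    have e10 := congrFun (congrFun h1 1) 0
    have e11 := congrFun (congrFun h2 0) 1
    simp [Matrix.mul_apply] at e01 e10 e11
    have z01 : g.1 0 1 = 0 := by
      have : (2 * Complex.I) * g.1 0 1 = 0 := by linear_combination -e01
      simpa [hI] using this
    have z10 : g.1 1 0 = 0 := by
      have : (2 * Complex.I) * g.1 1 0 = 0 := by linear_combination e10
      simpa [hI] using this
    rw [QuotientGroup.eq_one_iff, Matrix.SpecialLinearGroup.mem_center_iff]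
    have hd := g.2
    rw [Matrix.det_fin_two, z01] at hd
    refine ⟨g.1 0 0, ?_, ?_⟩
    · simp only [Fintype.card_fin]
      linear_combination hd + g.1 0 0 * e11
    · ext i j
      fin_cases i <;> fin_cases j <;> simp [Matrix.scalar_apply, z01, z10, ← e11]

/-- The action of `PSL(2, ℂ)` is free on pairs of lines without a common end-point. -/
lemma eq_of_smul_eq {g h : PSL(2, ℂ)} {l m : OrientedLine} (hlm : l.coshDist m ^ 2 ≠ 1)
    (hl : g • l = h • l) (hm : g • m = h • m) : g = h := by
  have hl' : (h⁻¹ * g) • l = l := by rw [mul_smul, hl, inv_smul_smul]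
  have hm' : (h⁻¹ * g) • m = m := by rw [mul_smul, hm, inv_smul_smul]
  suffices h⁻¹ * g = 1 from (inv_mul_eq_one.1 this).symm
  refine eq_one_of_forall_smul_eq fun x => eq_of_coshDist_of_triple hlm ?_ ?_ ?_
  · simpa only [hl'] using coshDist_smul (h⁻¹ * g) l x
  · simpa only [hm'] using coshDist_smul (h⁻¹ * g) m x
  · simpa only [hl', hm'] using triple_smul (h⁻¹ * g) l m x

/-- An invertible matrix which intertwines two line matrices can be scaled to determinant `1`. -/
lemma exists_smul_eq_of_mul_eq {l l' : OrientedLine} (P : Matrix (Fin 2) (Fin 2) ℂ)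
    (hP : P.det ≠ 0) (h : P * l.1.1 = l'.1.1 * P) : ∃ g : SL(2, ℂ), g • l = l' := by
  obtain ⟨d, hd⟩ := IsAlgClosed.exists_pow_nat_eq P.det zero_lt_two
  have hd0 : d ≠ 0 := by rintro rfl; exact hP (by simpa using hd.symm)
  refine ⟨⟨d⁻¹ • P, ?_⟩, ?_⟩
  · rw [Matrix.det_smul, ← hd]
    simp [hd0]
  · refine Subtype.ext ?_
    refine mul_inv_eq_iff_eq_mul.2 (Subtype.ext ?_)
    change (d⁻¹ • P) * l.1.1 = l'.1.1 * (d⁻¹ • P)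
    simp [h]

/-- The reference line, from `∞` to `0` in the upper half-space model. -/
noncomputable def axis : OrientedLine := ofEntries Complex.I 0 0 (by simp)

/-- `SL(2, ℂ)` acts transitively on oriented lines. -/
lemma exists_smul_axis (l : OrientedLine) : ∃ g : SL(2, ℂ), g • axis = l := by
  obtain ⟨a, b, c, h, e⟩ := l.exists_entries
  have hI := Complex.I_mul_I
  have hI0 := Complex.I_ne_zero
  -- the columns of the intertwining matrix are eigenvectors of `l` for `i` and `-i`
  by_cases hb : b = 0
  · by_cases hc : c = 0
    · have : (a - Complex.I) * (a + Complex.I) = 0 := by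
        rw [hb] at e; linear_combination e - hI
      rcases mul_eq_zero.1 this with ha | ha
      · refine exists_smul_eq_of_mul_eq 1 (by simp) ?_
        rw [one_mul, mul_one, h, sub_eq_zero.1 ha, hb, hc]
        rfl
      · refine exists_smul_eq_of_mul_eq !![0, 1; 1, 0] (by simp) ?_
        rw [h, eq_neg_of_add_eq_zero_left ha, hb, hc]
        simp [axis, ofEntries]
    · refine exists_smul_eq_of_mul_eq !![a + Complex.I, a - Complex.I; c, c] ?_ ?_
      · rw [Matrix.det_fin_two_of]
        have : (a + Complex.I) * c - (a - Complex.I) * c = 2 * Complex.I * c := by ring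
        rw [this]
        simp [hc]
      · rw [h]
        ext i j
        fin_cases i <;> fin_cases j <;> simp [axis, ofEntries]
        · linear_combination hI - e
        · linear_combination hI - e
        · ring
        · ring
  · refine exists_smul_eq_of_mul_eq !![b, b; Complex.I - a, -Complex.I - a] ?_ ?_
    · rw [Matrix.det_fin_two_of]
      have : b * (-Complex.I - a) - b * (Complex.I - a) = -(2 * Complex.I * b) := by ring
      rw [this]
      simp [hb]
    · rw [h]
      ext i j
      fin_cases i <;> fin_cases j <;> simp [axis, ofEntries]
      · ring
      · ring
      · linear_combination hI - e
      · linear_combination hI - e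

/-- A pair of lines without a common end-point can be moved to a normal form which depends only on
the complex distance (by `eq_of_first_row`, the first row determines the second line). -/
lemma exists_normalForm (l m : OrientedLine) (hlm : l.coshDist m ^ 2 ≠ 1) :
    ∃ g : PSL(2, ℂ), g • l = axis ∧
      ((g • m).1.1 0 0 = Complex.I * l.coshDist m ∧ (g • m).1.1 0 1 = 1) := by
  obtain ⟨k, rfl⟩ := exists_smul_axis l
  obtain ⟨n, rfl⟩ : ∃ n, m = k • n := ⟨k⁻¹ • m, by simp⟩
  have hc : (k • axis).coshDist (k • n) = axis.coshDist n := coshDist_smul (k : PSL(2, ℂ)) _ _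
  rw [hc] at hlm ⊢
  obtain ⟨a, b, c, h, e⟩ := n.exists_entries
  have ha : axis.coshDist n = -Complex.I * a := by
    simp [coshDist, axis, ofEntries, h, Matrix.trace_fin_two]
    ring
  have hb : b ≠ 0 := by
    rintro rfl
    apply hlm
    rw [ha]
    linear_combination a ^ 2 * Complex.I_sq - e
  obtain ⟨d, hd⟩ := IsAlgClosed.exists_pow_nat_eq b zero_lt_two
  have hd0 : d ≠ 0 := by rintro rfl; exact hb (by simpa using hd.symm)
  -- conjugation by `diag(1 / d, d)` fixes the axis and scales `b` by `1 / d ^ 2`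
  let D : SL(2, ℂ) := ⟨!![d⁻¹, 0; 0, d], by simp [hd0]⟩
  have hDi : D⁻¹.1 = !![d, 0; 0, d⁻¹] := by
    rw [Matrix.SpecialLinearGroup.coe_inv, Matrix.adjugate_fin_two_of]
    simp
  have hDm : ((D • n).1.1) = D.1 * n.1.1 * D⁻¹.1 := rfl
  have hDa : ((D • axis).1.1) = D.1 * axis.1.1 * D⁻¹.1 := rfl
  refine ⟨(D : PSL(2, ℂ)) * (k : PSL(2, ℂ))⁻¹, ?_, ?_⟩
  · have : ((D : PSL(2, ℂ)) * (k : PSL(2, ℂ))⁻¹) • k • axis = D • axis := by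
      rw [mul_smul, ← mk_smul k, inv_smul_smul, mk_smul]
    rw [this]
    refine ext_matrix ?_
    rw [hDa, hDi]
    ext i j
    fin_cases i <;> fin_cases j <;> simp [D, axis, ofEntries] <;> field_simp
  · have : ((D : PSL(2, ℂ)) * (k : PSL(2, ℂ))⁻¹) • k • n = D • n := by
      rw [mul_smul, ← mk_smul k, inv_smul_smul, mk_smul]
    rw [this, hDm, hDi, h, ha]
    constructor
    · simp [D]
      field_simp
      linear_combination a * Complex.I_sq
    · simp [D, ← hd]
      field_simp

/-- A line is determined by its first row, if it does not share an end-point with the axis. -/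
lemma eq_of_first_row {m n : OrientedLine} (h0 : m.1.1 0 0 = n.1.1 0 0)
    (h1 : m.1.1 0 1 = n.1.1 0 1) (hne : m.1.1 0 1 ≠ 0) : m = n := by
  obtain ⟨a, b, c, h, e⟩ := m.exists_entries
  obtain ⟨a', b', c', h', e'⟩ := n.exists_entries
  simp [h, h'] at h0 h1 hne
  subst h0 h1
  have : c = c' := mul_left_cancel₀ hne (by linear_combination e - e')
  exact ext_matrix (by rw [h, h', this])

/-- The reversed line. -/
instance : Neg OrientedLine := ⟨fun l => ⟨-l.1, by
  rw [Matrix.SpecialLinearGroup.coe_neg, Matrix.trace_neg, l.2, neg_zero]⟩⟩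

lemma coe_neg (l : OrientedLine) : (-l).1.1 = -l.1.1 := rfl

lemma smul_neg' (g : PSL(2, ℂ)) (l : OrientedLine) : g • (-l) = -(g • l) := by
  induction g using QuotientGroup.induction_on with
  | H g =>
    refine Subtype.ext ?_
    change g * (-l.1) * g⁻¹ = -(g * l.1 * g⁻¹)
    simp

lemma coshDist_neg_neg (l m : OrientedLine) : (-l).coshDist (-m) = l.coshDist m := by
  simp [coshDist, coe_neg]

lemma triple_neg_neg_neg (l m n : OrientedLine) :
    (-l).triple (-m) (-n) = -l.triple m n := by
  simp [triple, coe_neg]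

lemma triple_rotate (l m n : OrientedLine) : l.triple m n = m.triple n l := by
  rw [triple, mul_assoc, Matrix.trace_mul_comm, triple]

lemma triple_swap (l m n : OrientedLine) : m.triple l n = -l.triple m n := by
  obtain ⟨a, b, c, h, e⟩ := l.exists_entries
  obtain ⟨a', b', c', h', e'⟩ := m.exists_entries
  obtain ⟨a'', b'', c'', h'', e''⟩ := n.exists_entries
  simp only [triple, h, h', h'', Matrix.trace_fin_two, Matrix.mul_apply, Fin.sum_univ_two]
  simp
  ring

/-- The action of `PSL(2, ℂ)` is transitive on pairs of lines at a given complex distance. -/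
lemma exists_smul_eq_and_smul_eq {l m l' m' : OrientedLine} (hlm : l.coshDist m ^ 2 ≠ 1)
    (h : l.coshDist m = l'.coshDist m') : ∃ g : PSL(2, ℂ), g • l = l' ∧ g • m = m' := by
  obtain ⟨g, h1, h2, h3⟩ := exists_normalForm l m hlm
  obtain ⟨g', h1', h2', h3'⟩ := exists_normalForm l' m' (h ▸ hlm)
  have hm : g • m = g' • m' :=
    eq_of_first_row (by rw [h2, h2', h]) (by rw [h3, h3']) (by rw [h3]; exact one_ne_zero)
  refine ⟨g'⁻¹ * g, ?_, ?_⟩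
  · rw [mul_smul, h1, ← h1', inv_smul_smul]
  · rw [mul_smul, hm, inv_smul_smul]

/-- A diagonal matrix of determinant `1`. -/
def diagonalSL (a d : ℂ) (h : Matrix.det !![a, 0; 0, d] = 1) : SL(2, ℂ) := ⟨!![a, 0; 0, d], h⟩

/-- The stabiliser of the axis consists of diagonal matrices. -/
lemma exists_diagonal_of_smul_axis {g : PSL(2, ℂ)} (h : g • axis = axis) :
    ∃ (a d : ℂ) (h : Matrix.det !![a, 0; 0, d] = 1),
      g = (diagonalSL a d h : PSL(2, ℂ)) := by
  induction g using QuotientGroup.induction_on with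
  | H g =>
    have key : g * axis.1 = axis.1 * g :=
      mul_inv_eq_iff_eq_mul.1 (congrArg Subtype.val h)
    have h1 : g.1 * !![Complex.I, 0; 0, -Complex.I] = !![Complex.I, 0; 0, -Complex.I] * g.1 :=
      congrArg Subtype.val key
    have hI := Complex.I_ne_zero
    have e01 := congrFun (congrFun h1 0) 1
    have e10 := congrFun (congrFun h1 1) 0
    simp [Matrix.mul_apply] at e01 e10
    have z01 : g.1 0 1 = 0 := by
      have : (2 * Complex.I) * g.1 0 1 = 0 := by linear_combination -e01
      simpa [hI] using this
    have z10 : g.1 1 0 = 0 := by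
      have : (2 * Complex.I) * g.1 1 0 = 0 := by linear_combination e10
      simpa [hI] using this
    have hg : g.1 = !![g.1 0 0, 0; 0, g.1 1 1] := by
      conv_lhs => rw [Matrix.eta_fin_two g.1, z01, z10]
    exact ⟨g.1 0 0, g.1 1 1, hg ▸ g.2, congrArg _ (Subtype.ext hg)⟩

/-- The end-points `[1 : 0]` and `[0 : 1]` of the axis. -/
noncomputable def axisEnd (i : Fin 2) : Projectivization ℂ (Fin 2 → ℂ) :=
  Projectivization.mk ℂ (Pi.single i 1) (by simp)

lemma diagonal_smul_mk (a d : ℂ) (h : Matrix.det !![a, 0; 0, d] = 1) (v w : Fin 2 → ℂ)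
    (hv : v ≠ 0) (hw : w ≠ 0) :
    (diagonalSL a d h : PSL(2, ℂ)) • Projectivization.mk ℂ v hv =
      Projectivization.mk ℂ w hw ↔ ∃ c : ℂ, c * w 0 = a * v 0 ∧ c * w 1 = d * v 1 := by
  rw [Matrix.ProjectiveSpecialLinearGroup.smul_proj_mk, Projectivization.smul_mk,
    Projectivization.mk_eq_mk_iff']
  refine exists_congr fun c => ?_
  have hs : diagonalSL a d h • v = !![a, 0; 0, d].mulVec v := rfl
  rw [hs, funext_iff, Fin.forall_fin_two]
  simp [Matrix.mulVec, dotProduct]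

/-- A nontrivial diagonal matrix fixes no other points than the two end-points of the axis. -/
lemma axisEnd_of_fixed {a d : ℂ} (h : Matrix.det !![a, 0; 0, d] = 1)
    (hne : (diagonalSL a d h : PSL(2, ℂ)) ≠ 1)
    {y : Projectivization ℂ (Fin 2 → ℂ)}
    (hy : (diagonalSL a d h : PSL(2, ℂ)) • y = y) :
    y = axisEnd 0 ∨ y = axisEnd 1 := by
  induction y using Projectivization.ind with
  | h v hv =>
    obtain ⟨c, h0, h1⟩ := (diagonal_smul_mk a d h v v hv hv).1 hy
    have had : a ≠ d := by
      rintro rfl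
      apply hne
      rw [QuotientGroup.eq_one_iff, Matrix.SpecialLinearGroup.mem_center_iff]
      refine ⟨a, ?_, ?_⟩
      · rw [Matrix.det_fin_two_of] at h
        simp only [Fintype.card_fin]
        linear_combination h
      · ext i j
        fin_cases i <;> fin_cases j <;> simp [Matrix.scalar_apply, diagonalSL]
    have hv01 : v 0 = 0 ∨ v 1 = 0 := by
      by_contra! hcon
      exact had ((mul_right_cancel₀ hcon.1 h0).symm.trans (mul_right_cancel₀ hcon.2 h1))
    simp only [axisEnd, Projectivization.mk_eq_mk_iff', funext_iff, Fin.forall_fin_two]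
    rcases hv01 with h | h
    · exact Or.inr ⟨v 1, by simp [h]⟩
    · exact Or.inl ⟨v 0, by simp [h]⟩

lemma axisEnd_zero_ne_one : axisEnd 0 ≠ axisEnd 1 := by
  intro h
  rw [axisEnd, axisEnd, Projectivization.mk_eq_mk_iff'] at h
  obtain ⟨c, hc⟩ := h
  have := congrFun hc 0
  simp at this

/-- Isometries which preserve a line and are not all trivial have exactly two common fixed points on
the sphere at infinity. -/
lemma ncard_fixed_eq_two (S : Set PSL(2, ℂ)) (σ : OrientedLine) (hσ : ∀ g ∈ S, g • σ = σ)
    (hS : ∃ g ∈ S, g ≠ 1) :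
    {x : Projectivization ℂ (Fin 2 → ℂ) | ∀ g ∈ S, g • x = x}.ncard = 2 := by
  obtain ⟨k, hk⟩ := exists_smul_axis σ
  set κ : PSL(2, ℂ) := QuotientGroup.mk k with hκ
  rw [← mk_smul, ← hκ] at hk
  have hconj : ∀ g ∈ S, (κ⁻¹ * g * κ) • axis = axis := fun g hg => by
    rw [mul_smul, mul_smul, hk, hσ g hg, ← hk, inv_smul_smul]
  have hset : {x : Projectivization ℂ (Fin 2 → ℂ) | ∀ g ∈ S, g • x = x} =
      (fun x => κ • x) '' {axisEnd 0, axisEnd 1} := by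
    ext x
    constructor
    · intro hx
      obtain ⟨g, hg, hne⟩ := hS
      refine ⟨κ⁻¹ • x, ?_, by simp⟩
      obtain ⟨a, d, h, he⟩ := exists_diagonal_of_smul_axis (hconj g hg)
      refine axisEnd_of_fixed h ?_ ?_
      · rw [← he]
        intro h1
        apply hne
        have : g = κ * (κ⁻¹ * g * κ) * κ⁻¹ := by group
        rw [this, h1]
        group
      · rw [← he, mul_smul, mul_smul, smul_inv_smul, hx g hg]
    · rintro ⟨y, hy, rfl⟩ g hg
      obtain ⟨a, d, h, he⟩ := exists_diagonal_of_smul_axis (hconj g hg)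
      have : (κ⁻¹ * g * κ) • y = y := by
        rw [he]
        rcases hy with rfl | rfl
        · exact (diagonal_smul_mk ..).2 ⟨a, by simp⟩
        · exact (diagonal_smul_mk ..).2 ⟨d, by simp⟩
      rw [mul_smul, mul_smul, inv_smul_eq_iff] at this
      exact this
  rw [hset, Set.ncard_image_of_injective _ (MulAction.injective κ),
    Set.ncard_pair axisEnd_zero_ne_one]

end OrientedLine

/-! ### Ideal tetrahedra and their face identifications -/

namespace IdealTetrahedron

open unitInterval Topology

lemma lt_one (x : IdealTetrahedron) (i : Fin 4) : x.1 i < 1 := by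
  refine lt_of_le_of_ne ?_ (x.2.2.2 i)
  exact (Finset.single_le_sum (fun j _ => x.2.1 j) (Finset.mem_univ i)).trans_eq x.2.2.1

/-- The point of an ideal tetrahedron with given barycentric coordinates, all less than `1`. -/
def ofLT (x : Fin 4 → ℝ) (h0 : ∀ i, 0 ≤ x i) (h1 : ∑ i, x i = 1) (h : ∀ i, x i < 1) :
    IdealTetrahedron := ⟨x, h0, h1, fun i => (h i).ne⟩

lemma continuous_coord (i : Fin 4) : Continuous fun x : IdealTetrahedron => x.1 i :=
  (continuous_apply i).comp continuous_subtype_val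

/-- The straight segment from `x` to `y`. -/
def seg (x y : IdealTetrahedron) (u : I) : IdealTetrahedron :=
  ofLT (fun i => (1 - (u : ℝ)) * x.1 i + u * y.1 i)
    (fun i => add_nonneg (mul_nonneg (sub_nonneg.2 u.2.2) (x.2.1 i)) (mul_nonneg u.2.1 (y.2.1 i)))
    (by rw [Finset.sum_add_distrib, ← Finset.mul_sum, ← Finset.mul_sum, x.2.2.1, y.2.2.1]; ring)
    (fun i => by
      have hu := u.2.1
      have hu' := u.2.2
      have hx := x.lt_one i
      have hy := y.lt_one i
      rcases hu.eq_or_lt with h | h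
      · rw [← h]; simpa using hx
      · nlinarith)

lemma seg_coord (x y : IdealTetrahedron) (u : I) (i : Fin 4) :
    (seg x y u).1 i = (1 - (u : ℝ)) * x.1 i + u * y.1 i := rfl

lemma continuous_seg :
    Continuous fun p : IdealTetrahedron × IdealTetrahedron × I => seg p.1 p.2.1 p.2.2 := by
  refine Continuous.subtype_mk (continuous_pi fun i => ?_) _
  have h1 := (continuous_coord i).comp
    (continuous_fst (X := IdealTetrahedron) (Y := IdealTetrahedron × I))
  have h2 := (continuous_coord i).comp (continuous_fst.comp
    (continuous_snd (X := IdealTetrahedron) (Y := IdealTetrahedron × I)))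
  have h3 : Continuous fun p : IdealTetrahedron × IdealTetrahedron × I => (p.2.2 : ℝ) := by
    fun_prop
  exact ((continuous_const.sub h3).mul h1).add (h3.mul h2)

@[simp] lemma seg_zero (x y : IdealTetrahedron) : seg x y 0 = x :=
  Subtype.ext (funext fun i => by simp [seg_coord])

@[simp] lemma seg_one (x y : IdealTetrahedron) : seg x y 1 = y :=
  Subtype.ext (funext fun i => by simp [seg_coord])

/-- The straight path from `x` to `y`. -/
def segPath (x y : IdealTetrahedron) : Path x y where
  toFun u := seg x y u
  continuous_toFun := continuous_seg.comp
    (continuous_const.prodMk (continuous_const.prodMk continuous_id))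
  source' := seg_zero x y
  target' := seg_one x y

lemma segPath_apply (x y : IdealTetrahedron) (u : I) : segPath x y u = seg x y u := rfl

/-- The barycentre of the face spanned by a set `S` of at least two vertices. -/
noncomputable def bary (S : Finset (Fin 4)) (h : 2 ≤ S.card) : IdealTetrahedron :=
  ofLT (fun i => if i ∈ S then (S.card : ℝ)⁻¹ else 0)
    (fun i => by split_ifs <;> positivity)
    (by
      rw [Finset.sum_ite_mem, Finset.univ_inter, Finset.sum_const, nsmul_eq_mul]
      exact mul_inv_cancel₀ (by positivity))
    (fun i => by
      split_ifs
      · exact inv_lt_one_of_one_lt₀ (by exact_mod_cast h)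
      · exact one_pos)

/-- Relabelling of the vertices by `π`: the coordinate of `x` at `i` becomes that at `π i`. -/
def perm (π : Equiv.Perm (Fin 4)) (x : IdealTetrahedron) : IdealTetrahedron :=
  ofLT (fun i => x.1 (π.symm i)) (fun i => x.2.1 _)
    (by rw [Equiv.sum_comp π.symm x.1]; exact x.2.2.1) (fun i => x.lt_one _)

@[simp] lemma perm_apply (π : Equiv.Perm (Fin 4)) (x : IdealTetrahedron) (i : Fin 4) :
    (perm π x).1 (π i) = x.1 i := congrArg x.1 (π.symm_apply_apply i)

lemma perm_inv_perm (π : Equiv.Perm (Fin 4)) (x : IdealTetrahedron) : perm π⁻¹ (perm π x) = x :=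
  Subtype.ext (funext fun i => congrArg x.1 (π.symm_apply_apply i))

lemma continuous_perm (π : Equiv.Perm (Fin 4)) : Continuous (perm π) :=
  Continuous.subtype_mk (continuous_pi fun i => continuous_coord (π.symm i)) _

lemma perm_seg (π : Equiv.Perm (Fin 4)) (x y : IdealTetrahedron) (u : I) :
    perm π (seg x y u) = seg (perm π x) (perm π y) u := rfl

lemma card_map_le {S : Finset (Fin 4)} (π : Equiv.Perm (Fin 4)) (h : 2 ≤ S.card) :
    2 ≤ (S.map π.toEmbedding).card := by rwa [Finset.card_map]

lemma perm_bary (π : Equiv.Perm (Fin 4)) (S : Finset (Fin 4)) (h : 2 ≤ S.card) :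
    perm π (bary S h) = bary (S.map π.toEmbedding) (card_map_le π h) := by
  refine Subtype.ext (funext fun i => ?_)
  obtain ⟨j, rfl⟩ := π.surjective i
  rw [perm_apply]
  simp [bary, ofLT]

/-- The point `3 / 4 v + 1 / 4 w` close to the vertex `v`. -/
noncomputable def near (v w : Fin 4) (h : v ≠ w) : IdealTetrahedron :=
  ofLT (fun i => (if i = v then 3 / 4 else 0) + if i = w then 1 / 4 else 0)
    (fun i => by split_ifs <;> norm_num)
    (by simp [Finset.sum_add_distrib]; norm_num)
    (fun i => by
      split_ifs with h1 h2
      · exact absurd (h1.symm.trans h2) h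
      all_goals norm_num)

lemma near_self (v w : Fin 4) (h : v ≠ w) : 3 / 4 ≤ (near v w h).1 v := by
  simp [near, ofLT, h]

lemma near_of_ne (v w : Fin 4) (h : v ≠ w) {f : Fin 4} (hv : f ≠ v) (hw : f ≠ w) :
    (near v w h).1 f = 0 := by
  simp [near, ofLT, hv, hw]

instance : ContractibleSpace IdealTetrahedron := by
  have hc : Convex ℝ {x : Fin 4 → ℝ | (∀ i, 0 ≤ x i) ∧ ∑ i, x i = 1 ∧ ∀ i, x i ≠ 1} := by
    intro x hx y hy a b ha hb hab
    have he : a • x + b • y = (seg ⟨x, hx⟩ ⟨y, hy⟩ ⟨b, hb, by linarith⟩).1 := by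
      funext i
      change a * x i + b * y i = (1 - b) * x i + b * y i
      rw [← hab, add_sub_cancel_right]
    rw [he]
    exact (seg ⟨x, hx⟩ ⟨y, hy⟩ ⟨b, hb, by linarith⟩).2
  exact hc.contractibleSpace ⟨_, (near 0 1 (by decide)).2⟩

/-- The point `x` lies in the open star of the cell spanned by `S`: the coordinates in `S` are
positive and larger than the others. Each point lies in the star of at most one cell with a given
number of vertices, and the set `S` need not contain all vertices with positive coordinates. -/
def InStar (S : Finset (Fin 4)) (x : IdealTetrahedron) : Prop :=
  2 ≤ S.card ∧ ∀ i ∈ S, 0 < x.1 i ∧ ∀ k ∉ S, x.1 k < x.1 i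

lemma InStar.eq {S S' : Finset (Fin 4)} {x : IdealTetrahedron} (h : InStar S x)
    (h' : InStar S' x) (hc : S.card = S'.card) : S = S' := by
  by_contra hne
  have h1 : ¬ S ⊆ S' := fun hs => hne (Finset.eq_of_subset_of_card_le hs hc.ge)
  have h2 : ¬ S' ⊆ S := fun hs => hne (Finset.eq_of_subset_of_card_le hs hc.le).symm
  obtain ⟨i, hi, hi'⟩ := Finset.not_subset.1 h1
  obtain ⟨k, hk, hk'⟩ := Finset.not_subset.1 h2
  exact lt_asymm ((h.2 i hi).2 k hk') ((h'.2 k hk).2 i hi')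

lemma exists_inStar (x : IdealTetrahedron) : ∃ S, InStar S x := by
  classical
  refine ⟨Finset.univ.filter fun i => 0 < x.1 i, ?_, ?_⟩
  · by_contra! hlt
    have hsum : ∑ i ∈ Finset.univ.filter (fun i => 0 < x.1 i), x.1 i = 1 :=
      (Finset.sum_filter_of_ne fun i _ hi => lt_of_le_of_ne (x.2.1 i) hi.symm).trans x.2.2.1
    rcases Finset.card_le_one_iff_subset_singleton.1 (Nat.lt_succ_iff.1 hlt) with ⟨j, hj⟩
    rcases Finset.subset_singleton_iff.1 hj with h | h
    · rw [h] at hsum; simp at hsum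
    · rw [h, Finset.sum_singleton] at hsum
      exact x.2.2.2 j hsum
  · intro i hi
    have hi' : 0 < x.1 i := by simpa using hi
    refine ⟨hi', fun k hk => ?_⟩
    have : x.1 k ≤ 0 := by simpa using hk
    exact this.trans_lt hi'

lemma InStar.notMem {S : Finset (Fin 4)} {x : IdealTetrahedron} (h : InStar S x) {f : Fin 4}
    (hf : x.1 f = 0) : f ∉ S := fun hfS => (h.2 f hfS).1.ne' hf

lemma InStar.perm {S : Finset (Fin 4)} {x : IdealTetrahedron} (h : InStar S x)
    (π : Equiv.Perm (Fin 4)) : InStar (S.map π.toEmbedding) (perm π x) := by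
  refine ⟨card_map_le π h.1, fun i hi => ?_⟩
  obtain ⟨j, hj, rfl⟩ := Finset.mem_map.1 hi
  refine ⟨by simpa using (h.2 j hj).1, fun k hk => ?_⟩
  obtain ⟨l, rfl⟩ := π.surjective k
  have hl : l ∉ S := fun hl => hk (Finset.mem_map_of_mem _ hl)
  simpa using (h.2 j hj).2 l hl

lemma isOpen_inStar (S : Finset (Fin 4)) : IsOpen {x | InStar S x} := by
  have : {x | InStar S x} = {x | 2 ≤ S.card} ∩ ⋂ i ∈ S, ({x : IdealTetrahedron | 0 < x.1 i} ∩
      ⋂ k ∈ Finset.univ.filter (· ∉ S), {x : IdealTetrahedron | x.1 k < x.1 i}) := by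
    ext x
    simp [InStar]
  rw [this]
  refine isOpen_const.inter (isOpen_biInter_finset fun i _ =>
    (isOpen_lt continuous_const (continuous_coord i)).inter
      (isOpen_biInter_finset fun k _ => isOpen_lt (continuous_coord k) (continuous_coord i)))

end IdealTetrahedron

/-! ### Points of the triangulated space and the stars of its cells -/

namespace IdealTriangulation

open IdealTetrahedron unitInterval Topology

variable {T : Type*} (K : IdealTriangulation T)

lemma chart_glue (t : T) (f : Fin 4) (x : IdealTetrahedron) (hx : x.1 f = 0) :
    K.chart t x = K.chart (K.adj t f) (perm (K.glue t f) x) :=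
  Quot.sound ⟨f, hx, rfl, fun i => perm_apply _ x i⟩

lemma exists_chart_eq (m : K.Space) : ∃ t x, K.chart t x = m := by
  obtain ⟨⟨t, x⟩, rfl⟩ := Quot.exists_rep m
  exact ⟨t, x, rfl⟩

/-- A property of points of tetrahedra which is inherited across every face identification holds at
all representatives of a point of the space as soon as it holds at one of them. -/
lemma of_chart_eq {P : T → IdealTetrahedron → Prop}
    (hP : ∀ t x f, x.1 f = 0 → P t x → P (K.adj t f) (perm (K.glue t f) x))
    {t t' : T} {x x' : IdealTetrahedron} (h : K.chart t x = K.chart t' x') (hx : P t x) :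
    P t' x' := by
  have hrev : ∀ t x f, x.1 f = 0 → P (K.adj t f) (perm (K.glue t f) x) → P t x := by
    intro t x f hf hp
    have := hP _ _ (K.glue t f f) (by rwa [perm_apply]) hp
    rwa [K.adj_adj, K.glue_adj, perm_inv_perm] at this
  have key : ∀ a b : (_ : T) × IdealTetrahedron, Relation.EqvGen K.GlueRel a b →
      (P a.1 a.2 ↔ P b.1 b.2) := by
    intro a b hab
    induction hab with
    | rel a b hab =>
      obtain ⟨f, hf, h1, h2⟩ := hab
      obtain ⟨t, x⟩ := a
      obtain ⟨t', x'⟩ := b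
      dsimp only at h1 h2 hf ⊢
      subst h1
      have : x' = perm (K.glue t f) x := by
        refine Subtype.ext (funext fun i => ?_)
        obtain ⟨j, rfl⟩ := (K.glue t f).surjective i
        rw [perm_apply, h2]
      subst this
      exact ⟨hP t x f hf, hrev t x f hf⟩
    | refl a => exact Iff.rfl
    | symm a b _ ih => exact ih.symm
    | trans a b c _ _ ih1 ih2 => exact ih1.trans ih2
  exact (key ⟨t, x⟩ ⟨t', x'⟩ (Quot.eqvGen_exact h)).1 hx

/-- The union of the stars of the open cells with `n` vertices (the edges, faces and tetrahedra
for `n = 2, 3, 4`). -/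
def stars (n : ℕ) : Set K.Space :=
  {m | ∃ t x S, InStar S x ∧ S.card = n ∧ K.chart t x = m}

lemma exists_inStar_of_mem_stars {n : ℕ} {t : T} {x : IdealTetrahedron}
    (h : K.chart t x ∈ K.stars n) : ∃ S, InStar S x ∧ S.card = n := by
  obtain ⟨t', x', S, hS, hn, he⟩ := h
  refine K.of_chart_eq (P := fun _ x => ∃ S, InStar S x ∧ S.card = n) ?_ he ⟨S, hS, hn⟩
  rintro t x f - ⟨S, hS, hn⟩
  exact ⟨_, hS.perm _, by rwa [Finset.card_map]⟩

lemma exists_mem_stars (m : K.Space) : ∃ n, m ∈ K.stars n := by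
  obtain ⟨t, x, rfl⟩ := K.exists_chart_eq m
  obtain ⟨S, hS⟩ := exists_inStar x
  exact ⟨_, t, x, S, hS, rfl, rfl⟩

lemma isQuotientMap_chart :
    IsQuotientMap (fun p : (_ : T) × IdealTetrahedron => K.chart p.1 p.2) :=
  isQuotientMap_quot_mk (r := K.GlueRel)

/-- A set is open in the space if its preimages in all tetrahedra are. -/
lemma isOpen_of_chart {s : Set K.Space} (h : ∀ t, IsOpen {x | K.chart t x ∈ s}) : IsOpen s := by
  rw [← K.isQuotientMap_chart.isOpen_preimage, isOpen_sigma_iff]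
  exact h

lemma isOpen_stars (n : ℕ) : IsOpen (K.stars n) := by
  refine K.isOpen_of_chart fun t => ?_
  have : {x | K.chart t x ∈ K.stars n} = ⋃ (S) (_ : S.card = n), {x | InStar S x} := by
    ext x
    simp only [Set.mem_ofPred_eq, Set.mem_iUnion, exists_prop]
    constructor
    · intro h
      obtain ⟨S, hS, hn⟩ := K.exists_inStar_of_mem_stars h
      exact ⟨S, hn, hS⟩
    · rintro ⟨S, hn, hS⟩
      exact ⟨t, x, S, hS, hn, rfl⟩
  rw [this]
  exact isOpen_iUnion fun S => isOpen_iUnion fun _ => isOpen_inStar S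

/-- A map is continuous on an open set if it is so in each tetrahedron. -/
lemma continuousOn_of_chart {Y : Type*} [TopologicalSpace Y] {W : Set K.Space} (hW : IsOpen W)
    {F : K.Space → Y}
    (h : ∀ t x, K.chart t x ∈ W → ContinuousAt (fun x => F (K.chart t x)) x) :
    ContinuousOn F W := by
  rw [K.isQuotientMap_chart.continuousOn_isOpen_iff hW]
  rintro ⟨t, x⟩ hx
  refine ContinuousAt.continuousWithinAt ?_
  rw [ContinuousAt, Sigma.nhds_mk, Filter.tendsto_map'_iff]
  exact h t x hx

/-- A function is locally constant on an open set if it is so in each tetrahedron. -/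
lemma eventually_eq_of_chart {Y : Type*} {W : Set K.Space} (hW : IsOpen W) {F : K.Space → Y}
    (h : ∀ t x, K.chart t x ∈ W → ∀ᶠ y in 𝓝 x, F (K.chart t y) = F (K.chart t x))
    {m : K.Space} (hm : m ∈ W) : ∀ᶠ m' in 𝓝 m, F m' = F m := by
  let : TopologicalSpace Y := ⊥
  have : DiscreteTopology Y := ⟨rfl⟩
  have hF : ContinuousOn F W := K.continuousOn_of_chart hW fun t x hx => by
    rw [ContinuousAt, nhds_discrete Y, Filter.tendsto_pure]
    exact h t x hx
  have := hF.continuousAt (hW.mem_nhds hm)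
  rwa [ContinuousAt, nhds_discrete Y, Filter.tendsto_pure] at this

/-- The straight-line retractions of the stars of the cells with `n` vertices to their
barycentres, as a continuous family of paths. -/
lemma exists_retraction (n : ℕ) : ∃ R : K.Space → C(I, K.Space), ContinuousOn R (K.stars n) ∧
    ∀ t x S (h : InStar S x), S.card = n →
      ∀ u, R (K.chart t x) u = K.chart t (seg x (bary S h.1) u) := by
  have hex : ∀ m : K.Space, ∃ r : C(I, K.Space), ∀ t x S (h : InStar S x), S.card = n →
      K.chart t x = m → ∀ u, r u = K.chart t (seg x (bary S h.1) u) := by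
    intro m
    by_cases hm : ∃ t x S, InStar S x ∧ S.card = n ∧ K.chart t x = m
    · obtain ⟨t, x, S, hS, hn, rfl⟩ := hm
      refine ⟨(K.chart t).comp (segPath x (bary S hS.1)).toContinuousMap, ?_⟩
      intro t' x' S' hS' hn' he u
      have := K.of_chart_eq (P := fun t' x' => ∃ (S' : _) (h : InStar S' x'), S'.card = n ∧
        K.chart t (seg x (bary S hS.1) u) = K.chart t' (seg x' (bary S' h.1) u)) ?_ he.symm
        ⟨S, hS, hn, rfl⟩
      · obtain ⟨S'', hS'', hn'', h⟩ := this
        obtain rfl := hS''.eq hS' (hn''.trans hn'.symm)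
        exact h
      · rintro t₁ x₁ f hf ⟨S₁, hS₁, hn₁, h₁⟩
        refine ⟨_, hS₁.perm _, by rwa [Finset.card_map], h₁.trans ?_⟩
        rw [← perm_bary _ S₁ hS₁.1, ← perm_seg]
        refine K.chart_glue t₁ f _ ?_
        rw [seg_coord, hf]
        simp [bary, ofLT, hS₁.notMem hf]
    · exact ⟨ContinuousMap.const _ m, fun t x S h hn he => absurd ⟨t, x, S, h, hn, he⟩ hm⟩
  choose R hR using hex
  refine ⟨R, K.continuousOn_of_chart (K.isOpen_stars n) fun t x hx => ?_,
    fun t x S h hn => hR _ t x S h hn rfl⟩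
  obtain ⟨S, hS, hn⟩ := K.exists_inStar_of_mem_stars hx
  -- near `x` the retraction is given by straight segments to one and the same barycentre
  let G : C(IdealTetrahedron × I, K.Space) :=
    ⟨fun p => K.chart t (seg p.1 (bary S hS.1) p.2), (K.chart t).continuous.comp
      (continuous_seg.comp (continuous_fst.prodMk (continuous_const.prodMk continuous_snd)))⟩
  have hG : ContinuousAt (fun x => G.curry x) x := G.curry.continuous.continuousAt
  refine hG.congr ?_
  filter_upwards [(isOpen_inStar S).mem_nhds hS] with y hy
  ext u
  exact (hR _ t y S hy hn rfl u).symm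

/-- Classes of paths which are finite concatenations of paths inside tetrahedra. -/
inductive ChartGenerated : ∀ {m m' : K.Space}, Path.Homotopic.Quotient m m' → Prop
  | refl (m : K.Space) : ChartGenerated (Path.Homotopic.Quotient.refl m)
  | cons {m' : K.Space} (t : T) {x y : IdealTetrahedron} (c : Path x y)
      (q : Path.Homotopic.Quotient (K.chart t y) m') (hq : ChartGenerated q) :
      ChartGenerated
        ((Path.Homotopic.Quotient.mk (c.map (K.chart t).continuous)).trans q)

namespace ChartGenerated

variable {K}

lemma of_chart (t : T) {x y : IdealTetrahedron} (c : Path x y) :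
    K.ChartGenerated (Path.Homotopic.Quotient.mk (c.map (K.chart t).continuous)) := by
  simpa using ChartGenerated.cons (K := K) t c _ (.refl _)

lemma trans {m m' m'' : K.Space} {p : Path.Homotopic.Quotient m m'}
    {q : Path.Homotopic.Quotient m' m''} (hp : K.ChartGenerated p) (hq : K.ChartGenerated q) :
    K.ChartGenerated (p.trans q) := by
  induction hp with
  | refl m => simpa using hq
  | cons t c r _ ih =>
    rw [Path.Homotopic.Quotient.trans_assoc]
    exact .cons t c _ (ih hq)

lemma symm {m m' : K.Space} {p : Path.Homotopic.Quotient m m'} (hp : K.ChartGenerated p) :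
    K.ChartGenerated p.symm := by
  induction hp with
  | refl m => exact .refl m
  | cons t c r _ ih =>
    have h : ∀ {a b d : K.Space} (p : Path.Homotopic.Quotient a b)
        (q : Path.Homotopic.Quotient b d), (p.trans q).symm = q.symm.trans p.symm := by
      intro a b d p q
      induction p using Path.Homotopic.Quotient.ind with | mk p =>
      induction q using Path.Homotopic.Quotient.ind with | mk q =>
      simp only [← Path.Homotopic.Quotient.mk_trans, ← Path.Homotopic.Quotient.mk_symm,
        Path.trans_symm]
    rw [h]
    exact ih.trans (of_chart t c.symm)

lemma cast {m m' n n' : K.Space} {p : Path.Homotopic.Quotient m m'} (hp : K.ChartGenerated p)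
    (h : n = m) (h' : n' = m') : K.ChartGenerated (p.cast h h') := by
  subst h h'
  simpa using hp

end ChartGenerated

end IdealTriangulation

section Square

open unitInterval Topology

variable {X : Type*} [TopologicalSpace X]

/-- The two ways around the boundary of a square are homotopic. -/
lemma Path.homotopic_of_square (F : C(I × I, X)) {a b c d : X} (bottom : Path a b)
    (right : Path b d) (left : Path a c) (top : Path c d)
    (hb : ∀ s, bottom s = F (s, 0)) (hr : ∀ s, right s = F (1, s))
    (hl : ∀ s, left s = F (0, s)) (ht : ∀ s, top s = F (s, 1)) :
    (bottom.trans right).Homotopic (left.trans top) := by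
  obtain rfl : a = F (0, 0) := by rw [← hb, bottom.source]
  obtain rfl : b = F (1, 0) := by rw [← hb, bottom.target]
  obtain rfl : c = F (0, 1) := by rw [← hl, left.target]
  obtain rfl : d = F (1, 1) := by rw [← hr, right.target]
  have : ContractibleSpace I := (convex_Icc (0 : ℝ) 1).contractibleSpace ⟨0, by simp⟩
  let id' : Path (0 : I) 1 := Path.mk (ContinuousMap.id I) rfl rfl
  let b' : Path ((0, 0) : I × I) (1, 0) := id'.prod (Path.refl 0)
  let r' : Path ((1, 0) : I × I) (1, 1) := (Path.refl 1).prod id'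
  let l' : Path ((0, 0) : I × I) (0, 1) := (Path.refl 0).prod id'
  let t' : Path ((0, 1) : I × I) (1, 1) := id'.prod (Path.refl 1)
  have h := (SimplyConnectedSpace.paths_homotopic (b'.trans r') (l'.trans t')).map F
  rw [Path.map_trans, Path.map_trans] at h
  have e1 : b'.map F.continuous = bottom := Path.ext (funext fun s => (hb s).symm)
  have e2 : r'.map F.continuous = right := Path.ext (funext fun s => (hr s).symm)
  have e3 : l'.map F.continuous = left := Path.ext (funext fun s => (hl s).symm)
  have e4 : t'.map F.continuous = top := Path.ext (funext fun s => (ht s).symm)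
  rwa [e1, e2, e3, e4] at h

/-- A locally constant function on the unit interval is constant. -/
lemma unitInterval.eq_of_eventually_eq {Y : Type*} {f : I → Y}
    (h : ∀ s, ∀ᶠ s' in 𝓝 s, f s' = f s) (s s' : I) : f s = f s' :=
  ((IsLocallyConstant.iff_eventually_eq f).2 h).apply_eq_of_preconnectedSpace s s'

end Square

namespace IdealTriangulation

open IdealTetrahedron unitInterval Topology

variable {T : Type*} (K : IdealTriangulation T)

/-- A path in the stars of the cells with `n` vertices is homotopic to the concatenation of two
straight paths through a barycentre. -/
lemma chartGenerated_of_mem_stars {n : ℕ} {m m' : K.Space} (δ : Path m m')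
    (h : ∀ s, δ s ∈ K.stars n) : K.ChartGenerated (Path.Homotopic.Quotient.mk δ) := by
  obtain ⟨R, hRc, hR⟩ := K.exists_retraction n
  have hm : m ∈ K.stars n := by simpa using h 0
  have hm' : m' ∈ K.stars n := by simpa using h 1
  obtain ⟨t, x, S, hS, hn, rfl⟩ := hm
  obtain ⟨t', x', S', hS', hn', rfl⟩ := hm'
  let H : C(I, C(I, K.Space)) := ⟨fun s => R (δ s), hRc.comp_continuous δ.continuous h⟩
  have hF : ∀ s u, H.uncurry (s, u) = R (δ s) u := fun s u => rfl
  have hc : ∀ s, R (δ s) 1 = K.chart t' (bary S' hS'.1) := by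
    have h1 : R (δ 1) 1 = K.chart t' (bary S' hS'.1) := by
      rw [δ.target, hR t' x' S' hS' hn', seg_one]
    intro s
    rw [← h1]
    refine unitInterval.eq_of_eventually_eq (f := fun s => R (δ s) 1) (fun s => ?_) s 1
    refine δ.continuous.continuousAt.eventually
      (K.eventually_eq_of_chart (K.isOpen_stars n) (F := fun m => R m 1) (fun t x hx => ?_) (h s))
    obtain ⟨S, hS, hn⟩ := K.exists_inStar_of_mem_stars hx
    filter_upwards [(isOpen_inStar S).mem_nhds hS] with y hy
    rw [hR t x S hS hn, hR t y S hy hn, seg_one, seg_one]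
  have he : K.chart t (bary S hS.1) = K.chart t' (bary S' hS'.1) := by
    rw [← hc 0, δ.source, hR t x S hS hn, seg_one]
  have hsq := Path.homotopic_of_square H.uncurry δ
    ((segPath x' (bary S' hS'.1)).map (K.chart t').continuous)
    (((segPath x (bary S hS.1)).map (K.chart t).continuous).cast rfl he.symm) (Path.refl _)
    (fun s => by
      rw [hF]
      obtain ⟨t₁, x₁, S₁, hS₁, hn₁, h₁⟩ := h s
      rw [← h₁, hR t₁ x₁ S₁ hS₁ hn₁, seg_zero])
    (fun u => by rw [hF, δ.target, hR t' x' S' hS' hn']; rfl)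
    (fun u => by rw [hF, δ.source, hR t x S hS hn]; rfl)
    (fun s => by rw [hF, hc]; rfl)
  have hq := Path.Homotopic.Quotient.eq.2 hsq
  simp only [Path.Homotopic.Quotient.mk_trans, Path.Homotopic.Quotient.mk_refl,
    Path.Homotopic.Quotient.trans_refl, Path.Homotopic.Quotient.mk_cast] at hq
  have hq' := congrArg (fun q => q.trans (Path.Homotopic.Quotient.mk
    ((segPath x' (bary S' hS'.1)).map (K.chart t').continuous)).symm) hq
  simp only [Path.Homotopic.Quotient.trans_assoc, Path.Homotopic.Quotient.trans_symm,
    Path.Homotopic.Quotient.trans_refl] at hq'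
  rw [hq']
  exact ((ChartGenerated.of_chart t _).cast _ _).trans (ChartGenerated.of_chart t' _).symm

/-- Every path is homotopic to a finite concatenation of paths inside tetrahedra: being generated in
this way is a locally constant property of the initial segments of a path. -/
theorem chartGenerated {m m' : K.Space} (q : Path.Homotopic.Quotient m m') :
    K.ChartGenerated q := by
  induction q using Path.Homotopic.Quotient.ind with
  | mk δ =>
    let P : I → Prop := fun s => K.ChartGenerated (Path.Homotopic.Quotient.mk (δ.subpath 0 s))
    have h0 : P 0 := by
      simp only [P, Path.subpath_self, Path.Homotopic.Quotient.mk_refl]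
      exact .refl _
    have hstep : ∀ s s', K.ChartGenerated (Path.Homotopic.Quotient.mk (δ.subpath s s')) →
        P s → P s' := by
      intro s s' hs h
      have := Path.Homotopic.Quotient.eq.2 ⟨Path.Homotopy.subpathTransSubpath δ 0 s s'⟩
      rw [Path.Homotopic.Quotient.mk_trans] at this
      change K.ChartGenerated _
      rw [← this]
      exact h.trans hs
    have hloc : ∀ s, ∀ᶠ s' in 𝓝 s, P s' = P s := by
      intro s
      obtain ⟨n, hn⟩ := K.exists_mem_stars (δ s)
      have hU : δ ⁻¹' K.stars n ∈ 𝓝 s :=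
        δ.continuous.continuousAt.preimage_mem_nhds ((K.isOpen_stars n).mem_nhds hn)
      obtain ⟨a, c, hs, hac, hsub⟩ := exists_Icc_mem_subset_of_mem_nhds hU
      filter_upwards [hac] with s' hs'
      have hgen : ∀ u v, u ∈ Set.Icc a c → v ∈ Set.Icc a c →
          K.ChartGenerated (Path.Homotopic.Quotient.mk (δ.subpath u v)) := by
        intro u v hu hv
        refine K.chartGenerated_of_mem_stars (n := n) _ fun r => ?_
        have hr : δ.subpath u v r ∈ δ '' Set.uIcc u v := by
          rw [← Path.range_subpath]
          exact ⟨r, rfl⟩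
        obtain ⟨w, hw, hwr⟩ := hr
        rw [← hwr]
        exact hsub (Set.uIcc_subset_Icc hu hv hw)
      exact propext ⟨hstep _ _ (hgen s' s hs' hs), hstep _ _ (hgen s s' hs hs')⟩
    have h1 : P 1 := (unitInterval.eq_of_eventually_eq hloc 0 1) ▸ h0
    simp only [P, Path.subpath_zero_one, Path.Homotopic.Quotient.mk_cast] at h1
    simpa using h1.cast δ.source.symm δ.target.symm

end IdealTriangulation

/-! ### Loops from the base component of the cusp to the corners of a lifted tetrahedron -/

namespace IdealTriangulation

open IdealTetrahedron

variable {T : Type*} {K : IdealTriangulation T}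

lemma mk_map_chart_eq (t : T) {x y : IdealTetrahedron} (c c' : Path x y) :
    Path.Homotopic.Quotient.mk (c.map (K.chart t).continuous) =
      Path.Homotopic.Quotient.mk (c'.map (K.chart t).continuous) :=
  Path.Homotopic.Quotient.eq.2 ((SimplyConnectedSpace.paths_homotopic c c').map (K.chart t))

lemma trans_symm_trans {X : Type*} [TopologicalSpace X] {x y z : X}
    (p : Path.Homotopic.Quotient x y) (q : Path.Homotopic.Quotient x z) :
    p.trans (p.symm.trans q) = q := by
  rw [← Path.Homotopic.Quotient.trans_assoc, Path.Homotopic.Quotient.trans_symm,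
    Path.Homotopic.Quotient.refl_trans]

lemma forall_trans_mem {X : Type*} [TopologicalSpace X] {s : Set X} {x y z : X} {p : Path x y}
    {q : Path y z} (hp : ∀ u, p u ∈ s) (hq : ∀ u, q u ∈ s) (u : unitInterval) :
    p.trans q u ∈ s := by
  have : p.trans q u ∈ Set.range p ∪ Set.range q := by
    rw [← Path.trans_range]
    exact ⟨u, rfl⟩
  rcases this with ⟨v, hv⟩ | ⟨v, hv⟩
  · exact hv ▸ hp v
  · exact hv ▸ hq v

lemma seg_near {x y : IdealTetrahedron} {v : Fin 4} (hx : 3 / 4 ≤ x.1 v) (hy : 3 / 4 ≤ y.1 v)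
    (u : unitInterval) : 3 / 4 ≤ (seg x y u).1 v := by
  rw [seg_coord]
  nlinarith [u.2.1, u.2.2, mul_nonneg u.2.1 (sub_nonneg.2 hy),
    mul_nonneg (sub_nonneg.2 u.2.2) (sub_nonneg.2 hx)]

lemma exists_ne_ne (v f : Fin 4) : ∃ w, v ≠ w ∧ f ≠ w := by decide +revert

variable {b : K.Space}

/-- Two loops which lead to the same corner of a lifted tetrahedron differ by a peripheral
element. -/
lemma exists_peripheral {t : T} {y : IdealTetrahedron} {d : Path (K.chart t y) b} {v : Fin 4}
    {γ γ' : FundamentalGroup K.Space b} (h : γ ∈ cornerLoops t y d v)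
    (h' : γ' ∈ cornerLoops t y d v) : ∃ π ∈ peripheral b, γ = γ' * π := by
  obtain ⟨z, n, c, hz, hn, rfl⟩ := h
  obtain ⟨z', n', c', hz', hn', rfl⟩ := h'
  refine ⟨_, ⟨(n.trans ((segPath z z').map (K.chart t).continuous)).trans n'.symm, ?_, rfl⟩, ?_⟩
  · exact forall_trans_mem (forall_trans_mem hn
      fun u => ⟨t, _, v, seg_near hz hz' u, rfl⟩) fun u => hn' _
  · rw [FundamentalGroup.mul_def]
    have hc := mk_map_chart_eq (K := K) t c ((segPath z z').trans c')
    rw [Path.map_trans, Path.Homotopic.Quotient.mk_trans] at hc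
    simp only [FundamentalGroup.fromPath, FundamentalGroup.fromArrow,
      Path.Homotopic.Quotient.mk_trans, Path.Homotopic.Quotient.trans_assoc, hc,
      Path.Homotopic.Quotient.mk_symm]
    congr 2
    rw [← Path.Homotopic.Quotient.trans_assoc (Path.Homotopic.Quotient.mk n').symm,
      Path.Homotopic.Quotient.symm_trans, Path.Homotopic.Quotient.refl_trans]

lemma cornerLoops_congr {t : T} {y : IdealTetrahedron} {d d' : Path (K.chart t y) b} {v : Fin 4}
    (hd : Path.Homotopic.Quotient.mk d = Path.Homotopic.Quotient.mk d') :
    cornerLoops t y d v = cornerLoops t y d' v := by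
  ext γ
  simp only [cornerLoops, Path.Homotopic.Quotient.mk_trans, hd]

lemma mem_cornerLoops_of_map_trans {t : T} {y y' : IdealTetrahedron} (c : Path y y')
    {d : Path (K.chart t y') b} {v : Fin 4} {γ : FundamentalGroup K.Space b}
    (h : γ ∈ cornerLoops t y ((c.map (K.chart t).continuous).trans d) v) :
    γ ∈ cornerLoops t y' d v := by
  obtain ⟨z, n, c', hz, hn, rfl⟩ := h
  refine ⟨z, n, c'.trans c, hz, hn, ?_⟩
  simp only [Path.map_trans, Path.Homotopic.Quotient.mk_trans,
    Path.Homotopic.Quotient.trans_assoc]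

lemma mul_mem_cornerLoops {t : T} {y : IdealTetrahedron} {d : Path (K.chart t y) b} {v : Fin 4}
    {γ : FundamentalGroup K.Space b} (h : γ ∈ cornerLoops t y d v) (δ : Path b b) :
    FundamentalGroup.fromPath (Path.Homotopic.Quotient.mk δ) * γ ∈
      cornerLoops t y (d.trans δ) v := by
  obtain ⟨z, n, c, hz, hn, rfl⟩ := h
  refine ⟨z, n, c, hz, hn, ?_⟩
  rw [FundamentalGroup.mul_def]
  simp only [FundamentalGroup.fromPath, FundamentalGroup.fromArrow,
    Path.Homotopic.Quotient.mk_trans, Path.Homotopic.Quotient.trans_assoc]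

lemma joinedIn_near (t : T) {v : Fin 4} {z z' : IdealTetrahedron} (hz : 3 / 4 ≤ z.1 v)
    (hz' : 3 / 4 ≤ z'.1 v) : JoinedIn K.cusp (K.chart t z) (K.chart t z') :=
  ⟨(segPath z z').map (K.chart t).continuous, fun u => ⟨t, _, v, seg_near hz hz' u, rfl⟩⟩

/-- The neighbourhood of the only cusp is path connected. -/
lemma OneCusped.joinedIn (hK : K.OneCusped) (hb : b ∈ K.cusp) (t : T) {v : Fin 4}
    {z : IdealTetrahedron} (hz : 3 / 4 ≤ z.1 v) : JoinedIn K.cusp b (K.chart t z) := by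
  obtain ⟨t₀, z₀, v₀, hz₀, rfl⟩ := hb
  have key : ∀ c c' : T × Fin 4, Relation.EqvGen K.CornerRel c c' →
      ∀ z z' : IdealTetrahedron, 3 / 4 ≤ z.1 c.2 → 3 / 4 ≤ z'.1 c'.2 →
        JoinedIn K.cusp (K.chart c.1 z) (K.chart c'.1 z') := by
    intro c c' h
    induction h with
    | rel c c' h =>
      obtain ⟨f, hf, rfl⟩ := h
      intro z z' hz hz'
      obtain ⟨w, hw, hwf⟩ := exists_ne_ne c.2 f
      have h1 := joinedIn_near (K := K) c.1 hz (near_self c.2 w hw)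
      rw [K.chart_glue c.1 f _ (near_of_ne c.2 w hw hf hwf)] at h1
      refine h1.trans (joinedIn_near (K := K) _ ?_ hz')
      rw [perm_apply]
      exact near_self c.2 w hw
    | refl c => exact fun z z' hz hz' => joinedIn_near c.1 hz hz'
    | symm c c' _ ih => exact fun z z' hz hz' => (ih z' z hz' hz).symm
    | trans c c' c'' _ _ ih1 ih2 =>
      intro z z' hz hz'
      obtain ⟨w, hw⟩ := exists_ne c'.2
      exact (ih1 z _ hz (near_self c'.2 w hw.symm)).trans (ih2 _ z' (near_self c'.2 w hw.symm) hz')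
  exact key (t₀, v₀) (t, v) (hK _ _) z₀ z hz₀ hz

lemma cornerLoops_nonempty (hK : K.OneCusped) (hb : b ∈ K.cusp) (t : T) (y : IdealTetrahedron)
    (d : Path (K.chart t y) b) (v : Fin 4) : (cornerLoops t y d v).Nonempty := by
  obtain ⟨w, hw⟩ := exists_ne v
  have hz := near_self v w hw.symm
  obtain ⟨n, hn⟩ := hK.joinedIn hb t hz
  exact ⟨_, _, n, segPath _ y, hz, hn, rfl⟩

/-- Lifts of two adjacent tetrahedra which share a lift of a face have the same corners on it. -/
lemma exists_mem_cornerLoops_glue (hK : K.OneCusped) (hb : b ∈ K.cusp) (t : T)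
    (y : IdealTetrahedron) (f : Fin 4) (hf : y.1 f = 0) (d : Path (K.chart t y) b)
    (d' : Path (K.chart (K.adj t f) (perm (K.glue t f) y)) b) (hd : ∀ s, d' s = d s)
    (v : Fin 4) (hv : f ≠ v) :
    ∃ γ, γ ∈ cornerLoops t y d v ∧
      γ ∈ cornerLoops (K.adj t f) (perm (K.glue t f) y) d' (K.glue t f v) := by
  obtain ⟨w, hw, hwf⟩ := exists_ne_ne v f
  have hz := near_self v w hw
  obtain ⟨n, hn⟩ := hK.joinedIn hb t hz
  have hzf := near_of_ne v w hw hv hwf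
  -- both descriptions use one and the same path, which runs inside the common face
  refine ⟨_, ⟨_, n, segPath _ y, hz, hn, rfl⟩, perm (K.glue t f) (near v w hw),
    n.cast rfl (K.chart_glue t f _ hzf).symm,
    (segPath (near v w hw) y).map (continuous_perm (K.glue t f)), ?_, hn, ?_⟩
  · rwa [perm_apply]
  · congr 2
    have e1 := K.chart_glue t f _ hzf
    have e2 := K.chart_glue t f _ hf
    refine Path.ext (funext fun u => ?_)
    have h1 : ∀ u, K.chart t (segPath (near v w hw) y u) =
        K.chart (K.adj t f) (perm (K.glue t f) (segPath (near v w hw) y u)) := fun u => by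
      refine K.chart_glue t f _ ?_
      rw [segPath_apply, seg_coord, hzf, hf]
      simp
    simp only [Path.trans_apply, Path.map_coe, Function.comp_apply, Path.cast_coe, h1, hd]

/-! ### Comparison of two representations -/

variable {ρ ρ' : FundamentalGroup K.Space b →* PSL(2, ℂ)} {σ σ' : OrientedLine}

/-- The line at a corner of a lifted tetrahedron is well defined. -/
lemma smul_eq_of_mem_cornerLoops (hρ : ∀ γ ∈ peripheral b, ρ γ • σ = σ) {t : T}
    {y : IdealTetrahedron} {d : Path (K.chart t y) b} {v : Fin 4}
    {γ γ' : FundamentalGroup K.Space b} (h : γ ∈ cornerLoops t y d v)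
    (h' : γ' ∈ cornerLoops t y d v) : ρ γ • σ = ρ γ' • σ := by
  obtain ⟨π, hπ, rfl⟩ := exists_peripheral h h'
  rw [map_mul, mul_smul, hρ π hπ]

/-- For the lift of `t` determined by `y` and `d`, the isometry `g` takes the lines at the corners
given by `(ρ, σ)` to the lines given by `(ρ', σ')`. -/
def Carries (ρ ρ' : FundamentalGroup K.Space b →* PSL(2, ℂ)) (σ σ' : OrientedLine)
    (g : PSL(2, ℂ)) (t : T) (y : IdealTetrahedron) (d : Path (K.chart t y) b) : Prop :=
  ∀ v, ∀ γ ∈ cornerLoops t y d v, g • ρ γ • σ = ρ' γ • σ'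

lemma Carries.congr {g : PSL(2, ℂ)} {t : T} {y : IdealTetrahedron} {d d' : Path (K.chart t y) b}
    (h : Carries ρ ρ' σ σ' g t y d)
    (hd : Path.Homotopic.Quotient.mk d' = Path.Homotopic.Quotient.mk d) :
    Carries ρ ρ' σ σ' g t y d' := fun v γ hγ => h v γ (cornerLoops_congr hd ▸ hγ)

lemma Carries.map_trans {g : PSL(2, ℂ)} {t : T} {y y' : IdealTetrahedron}
    {d : Path (K.chart t y') b} (h : Carries ρ ρ' σ σ' g t y' d) (c : Path y y') :
    Carries ρ ρ' σ σ' g t y ((c.map (K.chart t).continuous).trans d) :=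
  fun v γ hγ => h v γ (mem_cornerLoops_of_map_trans c hγ)

lemma Carries.trans (hK : K.OneCusped) (hb : b ∈ K.cusp)
    (hρ : ∀ γ ∈ peripheral b, ρ γ • σ = σ) (hρ' : ∀ γ ∈ peripheral b, ρ' γ • σ' = σ')
    {g : PSL(2, ℂ)} {t : T} {y : IdealTetrahedron} {d : Path (K.chart t y) b}
    (h : Carries ρ ρ' σ σ' g t y d) (δ : Path b b) :
    Carries ρ ρ' σ σ' (ρ' (FundamentalGroup.fromPath (Path.Homotopic.Quotient.mk δ)) * g *
      (ρ (FundamentalGroup.fromPath (Path.Homotopic.Quotient.mk δ)))⁻¹) t y (d.trans δ) := by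
  intro v γ hγ
  obtain ⟨γ₀, hγ₀⟩ := cornerLoops_nonempty hK hb t y d v
  have h1 := mul_mem_cornerLoops hγ₀ δ
  rw [smul_eq_of_mem_cornerLoops hρ hγ h1, smul_eq_of_mem_cornerLoops hρ' hγ h1, map_mul, map_mul,
    mul_smul, mul_smul, mul_smul, mul_smul, inv_smul_smul, h v γ₀ hγ₀]

/-- The lines at any two corners of a lifted tetrahedron have no end-point in common. -/
def Generic (ρ : FundamentalGroup K.Space b →* PSL(2, ℂ)) (σ : OrientedLine) : Prop :=
  ∀ (t : T) (i j : Fin 4), i ≠ j → ∀ (y : IdealTetrahedron) (d : Path (K.chart t y) b),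
    ∀ γ₁ ∈ cornerLoops t y d i, ∀ γ₂ ∈ cornerLoops t y d j,
      (ρ γ₁ • σ).coshDist (ρ γ₂ • σ) ^ 2 ≠ 1

lemma eq_of_carries (hK : K.OneCusped) (hb : b ∈ K.cusp) (hgen : Generic ρ σ)
    {g g' : PSL(2, ℂ)} {t : T} {y : IdealTetrahedron} {d : Path (K.chart t y) b}
    (h : Carries ρ ρ' σ σ' g t y d) (h' : Carries ρ ρ' σ σ' g' t y d) : g = g' := by
  obtain ⟨γ₁, h₁⟩ := cornerLoops_nonempty hK hb t y d 0
  obtain ⟨γ₂, h₂⟩ := cornerLoops_nonempty hK hb t y d 1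
  exact OrientedLine.eq_of_smul_eq (hgen t 0 1 (by decide) y d γ₁ h₁ γ₂ h₂)
    ((h 0 γ₁ h₁).trans (h' 0 γ₁ h₁).symm) ((h 1 γ₂ h₂).trans (h' 1 γ₂ h₂).symm)

/-- Induction along paths inside tetrahedra which end at the base point. -/
lemma quotient_induction {P : ∀ m : K.Space, Path.Homotopic.Quotient m b → Prop}
    (h0 : P b (Path.Homotopic.Quotient.refl b))
    (hs : ∀ (t : T) (x y : IdealTetrahedron) (c : Path x y)
      (q : Path.Homotopic.Quotient (K.chart t y) b), P _ q →
        P _ ((Path.Homotopic.Quotient.mk (c.map (K.chart t).continuous)).trans q))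
    {m : K.Space} (q : Path.Homotopic.Quotient m b) : P m q := by
  have key : ∀ {m m' : K.Space} (q : Path.Homotopic.Quotient m m'), K.ChartGenerated q →
      ∀ h : b = m', P m (q.cast rfl h) := by
    intro m m' q hq
    induction hq with
    | refl m =>
      rintro rfl
      simpa using h0
    | cons t c q _ ih =>
      rintro rfl
      have := hs t _ _ c _ (ih rfl)
      simpa using this
  simpa using key q (K.chartGenerated q) rfl

/-- If the lines given by `(ρ, σ)` and `(ρ', σ')` at the corners of one lift of each tetrahedron are
isometric, then the representations are conjugate: the isometries agree for any two lifts with a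
common face, and the lifts form a connected space. -/
theorem repConj_of_carries (hK : K.OneCusped) (hb : b ∈ K.cusp)
    (hρ : ∀ γ ∈ peripheral b, ρ γ • σ = σ) (hρ' : ∀ γ ∈ peripheral b, ρ' γ • σ' = σ')
    (hgen : Generic ρ σ) (h : ∀ t, ∃ y d g, Carries ρ ρ' σ σ' g t y d) : RepConj ρ ρ' := by
  have hA : ∀ t y (d : Path (K.chart t y) b), ∃ g, Carries ρ ρ' σ σ' g t y d := by
    intro t y d
    obtain ⟨y₀, d₀, g, hg⟩ := h t
    let c := (segPath y y₀).map (K.chart t).continuous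
    refine ⟨_, ((hg.trans hK hb hρ hρ' ((d₀.symm.trans c.symm).trans d)).map_trans
      (segPath y y₀)).congr ?_⟩
    simp only [c, Path.Homotopic.Quotient.mk_trans, Path.Homotopic.Quotient.mk_symm,
      Path.Homotopic.Quotient.trans_assoc, trans_symm_trans]
  have hB : ∀ g t y f (d : Path (K.chart t y) b)
      (d' : Path (K.chart (K.adj t f) (perm (K.glue t f) y)) b), y.1 f = 0 → (∀ s, d' s = d s) →
      Carries ρ ρ' σ σ' g t y d →
        Carries ρ ρ' σ σ' g (K.adj t f) (perm (K.glue t f) y) d' := by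
    intro g t y f d d' hf hd hg
    obtain ⟨g', hg'⟩ := hA _ _ d'
    obtain ⟨v, hv, -⟩ := exists_ne_ne f f
    obtain ⟨w, hw, hvw⟩ := exists_ne_ne f v
    obtain ⟨γ₁, h₁, h₁'⟩ := exists_mem_cornerLoops_glue hK hb t y f hf d d' hd v hv
    obtain ⟨γ₂, h₂, h₂'⟩ := exists_mem_cornerLoops_glue hK hb t y f hf d d' hd w hw
    have : g = g' := OrientedLine.eq_of_smul_eq (hgen t v w hvw y d γ₁ h₁ γ₂ h₂)
      ((hg v γ₁ h₁).trans (hg' _ γ₁ h₁').symm) ((hg w γ₂ h₂).trans (hg' _ γ₂ h₂').symm)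
    exact this ▸ hg'
  have hC : ∀ g t y t' y' (d : Path (K.chart t y) b) (he : K.chart t' y' = K.chart t y),
      Carries ρ ρ' σ σ' g t y d → Carries ρ ρ' σ σ' g t' y' (d.cast he rfl) := by
    intro g t y t' y' d he hg
    refine K.of_chart_eq (P := fun t' y' => ∀ he : K.chart t' y' = K.chart t y,
      Carries ρ ρ' σ σ' g t' y' (d.cast he rfl)) ?_ he.symm (fun _ => hg) he
    intro t₁ y₁ f hf h₁ he
    exact hB g t₁ y₁ f (d.cast ((K.chart_glue t₁ f y₁ hf).trans he) rfl) _ hf (fun s => rfl)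
      (h₁ _)
  obtain ⟨t₀, y₀, rfl⟩ := K.exists_chart_eq b
  obtain ⟨g, hg⟩ := hA t₀ y₀ (Path.refl _)
  have hE : ∀ (m : K.Space) (q : Path.Homotopic.Quotient m (K.chart t₀ y₀)),
      ∀ t y (he : K.chart t y = m) (d : Path (K.chart t y) (K.chart t₀ y₀)),
        Path.Homotopic.Quotient.mk d = q.cast he rfl → Carries ρ ρ' σ σ' g t y d := by
    intro m q
    refine quotient_induction (P := fun m q => ∀ t y (he : K.chart t y = m)
      (d : Path (K.chart t y) (K.chart t₀ y₀)), Path.Homotopic.Quotient.mk d = q.cast he rfl →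
        Carries ρ ρ' σ σ' g t y d) ?_ ?_ q
    · intro t y he d hd
      exact (hC g t₀ y₀ t y _ he hg).congr hd
    · intro t₁ x₁ y₁ c q ih t y he d hd
      induction q using Path.Homotopic.Quotient.ind with
      | mk d₁ =>
        have h1 := (ih t₁ y₁ rfl d₁ (by simp)).map_trans c
        exact (hC g _ _ t y _ he h1).congr hd
  refine ⟨g, fun δ => ?_⟩
  induction δ using Path.Homotopic.Quotient.ind with
  | mk δ =>
    have h1 := hE _ (Path.Homotopic.Quotient.mk δ) t₀ y₀ rfl δ (by simp)
    have h2 := (hg.trans hK hb hρ hρ' δ).congr (d' := δ) (by simp)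
    rw [eq_mul_inv_iff_mul_eq, ← mul_inv_eq_iff_eq_mul]
    exact eq_of_carries hK hb hgen h2 h1

end IdealTriangulation

/-! ### The realisation induced by a representation -/

namespace IdealTriangulation

open IdealTetrahedron

variable {T : Type*} {K : IdealTriangulation T} {b : K.Space}
  {ρ ρ' : FundamentalGroup K.Space b →* PSL(2, ℂ)} {σ σ' : OrientedLine} {p : K.Edge → ℂ}

lemma exists_path (hK : K.OneCusped) (hb : b ∈ K.cusp) (t : T) (y : IdealTetrahedron) :
    Nonempty (Path (K.chart t y) b) := by
  obtain ⟨n, -⟩ := hK.joinedIn hb t (near_self 0 1 (by decide))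
  exact ⟨((segPath y _).map (K.chart t).continuous).trans n.symm⟩

/-- Lifts of one tetrahedron are translates of each other, so the hextets given by `(ρ, σ)` at all
of them are isometric. -/
lemma exists_induces (hK : K.OneCusped) (hb : b ∈ K.cusp)
    (hρ : ∀ γ ∈ peripheral b, ρ γ • σ = σ) : ∃ H, Induces ρ σ H := by
  have y₀ := near 0 1 (by decide)
  have d₀ : ∀ t, Path (K.chart t y₀) b := fun t => (exists_path hK hb t y₀).some
  choose γ₀ hγ₀ using fun t v => cornerLoops_nonempty hK hb t y₀ (d₀ t) v
  refine ⟨fun t v => ρ (γ₀ t v) • σ, fun t y d => ?_⟩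
  let c := (segPath y₀ y).map (K.chart t).continuous
  let δ := ((d₀ t).symm.trans c).trans d
  refine ⟨ρ (FundamentalGroup.fromPath (Path.Homotopic.Quotient.mk δ)), fun v γ hγ => ?_⟩
  have h1 := mul_mem_cornerLoops (hγ₀ t v) δ
  have h2 : γ ∈ cornerLoops t y₀ ((d₀ t).trans δ) v := by
    refine mem_cornerLoops_of_map_trans (segPath y y₀) (d := (d₀ t).trans δ) ?_
    rwa [← cornerLoops_congr (d := d)]
    have hc : Path.Homotopic.Quotient.mk ((segPath y y₀).map (K.chart t).continuous) =
        (Path.Homotopic.Quotient.mk c).symm := mk_map_chart_eq t _ (segPath y₀ y).symm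
    have hs : ∀ {x y z : K.Space} (p : Path.Homotopic.Quotient x y)
        (q : Path.Homotopic.Quotient y z), p.symm.trans (p.trans q) = q := by
      intro x y z p q
      rw [← Path.Homotopic.Quotient.trans_assoc, Path.Homotopic.Quotient.symm_trans,
        Path.Homotopic.Quotient.refl_trans]
    simp only [δ, Path.Homotopic.Quotient.mk_trans, Path.Homotopic.Quotient.mk_symm,
      Path.Homotopic.Quotient.trans_assoc, trans_symm_trans, hc, hs]
  rw [smul_eq_of_mem_cornerLoops hρ h2 h1, map_mul, mul_smul]

lemma Induces.isCoherentRealisation (hK : K.OneCusped) (hb : b ∈ K.cusp)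
    {H : T → Fin 4 → OrientedLine} (hH : Induces ρ σ H) (hρ : HasOrtholengthsAlong ρ σ p) :
    K.IsCoherentRealisation p H := by
  refine ⟨fun t i j hij => ?_, fun t f => ?_⟩
  · have y := near 0 1 (by decide)
    obtain ⟨d⟩ := exists_path hK hb t y
    obtain ⟨g, hg⟩ := hH t y d
    obtain ⟨γ₁, h₁⟩ := cornerLoops_nonempty hK hb t y d i
    obtain ⟨γ₂, h₂⟩ := cornerLoops_nonempty hK hb t y d j
    rw [← hρ.2 t i j hij y d γ₁ h₁ γ₂ h₂, hg i γ₁ h₁, hg j γ₂ h₂, OrientedLine.coshDist_smul]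
  · obtain ⟨v, hv, -⟩ := exists_ne_ne f f
    obtain ⟨w, hw, hvw⟩ := exists_ne_ne f v
    have hf := near_of_ne v w hvw hv hw
    obtain ⟨d⟩ := exists_path hK hb t (near v w hvw)
    let d' := d.cast (K.chart_glue t f _ hf).symm rfl
    obtain ⟨g, hg⟩ := hH _ _ d
    obtain ⟨g', hg'⟩ := hH _ _ d'
    refine ⟨g'⁻¹ * g, fun u hu => ?_⟩
    obtain ⟨γ, h1, h2⟩ := exists_mem_cornerLoops_glue hK hb t _ f hf d d' (fun _ => rfl) u hu.symm
    rw [mul_smul, ← hg u γ h1, hg' _ γ h2, inv_smul_smul]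

lemma sq_ne_one (hp : p ∈ K.ortholengthSpace \ K.setT) (e : K.Edge) : p e ^ 2 ≠ 1 := by
  intro h
  exact hp.2 ⟨hp.1, e, sq_eq_sq_iff_eq_or_eq_neg.1 (h.trans (one_pow 2).symm)⟩

lemma HasOrtholengthsAlong.generic (hp : p ∈ K.ortholengthSpace \ K.setT)
    (hρ : HasOrtholengthsAlong ρ σ p) : Generic ρ σ := by
  intro t i j hij y d γ₁ h₁ γ₂ h₂
  rw [hρ.2 t i j hij y d γ₁ h₁ γ₂ h₂]
  exact sq_ne_one hp _

/-- Representations which induce realisations by isometric hextets are conjugate. -/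
lemma repConj_of_induces (hK : K.OneCusped) (hb : b ∈ K.cusp)
    (hp : p ∈ K.ortholengthSpace \ K.setT) (hρ : HasOrtholengthsAlong ρ σ p)
    (hρ' : HasOrtholengthsAlong ρ' σ' p) {H H' : T → Fin 4 → OrientedLine} (hH : Induces ρ σ H)
    (hH' : Induces ρ' σ' H') (h : ∀ t, ∃ g : PSL(2, ℂ), ∀ v, g • H t v = H' t v) :
    RepConj ρ ρ' := by
  refine repConj_of_carries hK hb hρ.1 hρ'.1 (hρ.generic hp) fun t => ?_
  obtain ⟨d⟩ := exists_path hK hb t (near 0 1 (by decide))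
  obtain ⟨g, hg⟩ := h t
  obtain ⟨k, hk⟩ := hH t _ d
  obtain ⟨k', hk'⟩ := hH' t _ d
  refine ⟨_, d, k' * g * k⁻¹, fun v γ hγ => ?_⟩
  rw [hk v γ hγ, hk' v γ hγ, mul_smul, mul_smul, inv_smul_smul, hg]

lemma HasOrtholengthsAlong.neg (hρ : HasOrtholengthsAlong ρ σ p) :
    HasOrtholengthsAlong ρ (-σ) p := by
  refine ⟨fun γ hγ => by rw [OrientedLine.smul_neg', hρ.1 γ hγ], ?_⟩
  intro t i j hij y d γ₁ h₁ γ₂ h₂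
  rw [OrientedLine.smul_neg', OrientedLine.smul_neg', OrientedLine.coshDist_neg_neg]
  exact hρ.2 t i j hij y d γ₁ h₁ γ₂ h₂

/-! ### Hextets with given parameters -/

/-- The triple invariant of the three lines on the face `f` of `t`. -/
def faceTriple (H : T → Fin 4 → OrientedLine) (t : T) (f : Fin 4) : ℂ :=
  (H t (f.succAbove 0)).triple (H t (f.succAbove 1)) (H t (f.succAbove 2))

lemma IsRealisation.hextetMatrix_apply {H : T → Fin 4 → OrientedLine}
    (hH : K.IsRealisation p H) (t : T) (i j : Fin 4) :
    K.hextetMatrix p t i j = (H t i).coshDist (H t j) := by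
  by_cases h : i = j
  · subst h
    simp [hextetMatrix, OrientedLine.coshDist_self]
  · simp [hextetMatrix, h, hH t i j h]

/-- The parameters determine the triple invariant of a face up to sign. -/
lemma IsRealisation.faceTriple_sq {H : T → Fin 4 → OrientedLine} (hH : K.IsRealisation p H)
    (t : T) (f : Fin 4) : faceTriple H t f ^ 2 = 4 * K.faceDet p t f := by
  rw [faceTriple, OrientedLine.triple_sq, faceDet, Matrix.det_fin_three]
  simp only [Matrix.submatrix_apply, hH.hextetMatrix_apply, OrientedLine.coshDist_self]
  rw [OrientedLine.coshDist_comm (H t (f.succAbove 1)) (H t (f.succAbove 0)),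
    OrientedLine.coshDist_comm (H t (f.succAbove 2)) (H t (f.succAbove 0)),
    OrientedLine.coshDist_comm (H t (f.succAbove 2)) (H t (f.succAbove 1))]
  ring

/-- Hextets with the same parameters and the same triple invariants of two faces are isometric. -/
lemma exists_smul_eq_of_faceTriple (hp : p ∈ K.ortholengthSpace \ K.setT)
    {H H' : T → Fin 4 → OrientedLine} (hH : K.IsRealisation p H) (hH' : K.IsRealisation p H')
    {t : T} (h2 : faceTriple H t 2 = faceTriple H' t 2)
    (h3 : faceTriple H t 3 = faceTriple H' t 3) :
    ∃ g : PSL(2, ℂ), ∀ v, g • H t v = H' t v := by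
  have hc : ∀ i j, (H t i).coshDist (H t j) = (H' t i).coshDist (H' t j) := fun i j => by
    rw [← hH.hextetMatrix_apply, hH'.hextetMatrix_apply]
  have hne : (H t 0).coshDist (H t 1) ^ 2 ≠ 1 := by
    rw [hH t 0 1 (by decide)]
    exact sq_ne_one hp _
  obtain ⟨g, h0, h1⟩ := OrientedLine.exists_smul_eq_and_smul_eq hne (hc 0 1)
  have key : ∀ v, (H t 0).triple (H t 1) (H t v) = (H' t 0).triple (H' t 1) (H' t v) →
      g • H t v = H' t v := fun v hv => by
    refine OrientedLine.eq_of_coshDist_of_triple (hc 0 1 ▸ hne) ?_ ?_ ?_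
    · rw [← h0, OrientedLine.coshDist_smul, h0, hc]
    · rw [← h1, OrientedLine.coshDist_smul, h1, hc]
    · rw [← h0, ← h1, OrientedLine.triple_smul, h0, h1, hv]
  refine ⟨g, fun v => ?_⟩
  fin_cases v
  · exact h0
  · exact h1
  · exact key 2 h3
  · exact key 3 h2

/-- Only finitely many representations, up to conjugacy, have given ortholengths. -/
theorem exists_finset_repConj [Finite T] (hK : K.OneCusped) (hb : b ∈ K.cusp)
    (hp : p ∈ K.ortholengthSpace \ K.setT) :
    ∃ R : Finset (FundamentalGroup K.Space b →* PSL(2, ℂ)),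
      ∀ (ρ : FundamentalGroup K.Space b →* PSL(2, ℂ)) (σ : OrientedLine),
        HasOrtholengthsAlong ρ σ p → ∃ ρ' ∈ R, RepConj ρ' ρ := by
  classical
  have hroots : ∀ c : ℂ, {z : ℂ | z ^ 2 = c}.Finite := fun c => by
    obtain ⟨r, hr⟩ := IsAlgClosed.exists_pow_nat_eq c zero_lt_two
    refine (Set.toFinite {r, -r}).subset fun z hz => ?_
    exact sq_eq_sq_iff_eq_or_eq_neg.1 (Eq.trans hz hr.symm)
  let S : Set (T → ℂ × ℂ) := Set.pi Set.univ fun t =>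
    {z : ℂ | z ^ 2 = 4 * K.faceDet p t 2} ×ˢ {z : ℂ | z ^ 2 = 4 * K.faceDet p t 3}
  have hS : S.Finite := Set.Finite.pi fun t => (hroots _).prod (hroots _)
  -- `Inv ρ i`: the triple invariants of some realisation induced by `ρ` are `i`
  let Inv : (FundamentalGroup K.Space b →* PSL(2, ℂ)) → (T → ℂ × ℂ) → Prop := fun ρ i =>
    ∃ σ H, HasOrtholengthsAlong ρ σ p ∧ Induces ρ σ H ∧
      i = fun t => (faceTriple H t 2, faceTriple H t 3)
  let rep : (T → ℂ × ℂ) → (FundamentalGroup K.Space b →* PSL(2, ℂ)) := fun i =>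
    if h : ∃ ρ, Inv ρ i then h.choose else 1
  refine ⟨hS.toFinset.image rep, fun ρ σ hρ => ?_⟩
  obtain ⟨H, hH⟩ := exists_induces hK hb hρ.1
  have hHr := (hH.isCoherentRealisation hK hb hρ).1
  let i : T → ℂ × ℂ := fun t => (faceTriple H t 2, faceTriple H t 3)
  have hi : ∃ ρ, Inv ρ i := ⟨ρ, σ, H, hρ, hH, rfl⟩
  refine ⟨rep i, Finset.mem_image_of_mem _ (hS.mem_toFinset.2 fun t _ =>
    ⟨hHr.faceTriple_sq t 2, hHr.faceTriple_sq t 3⟩), ?_⟩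
  have hrep : Inv (rep i) i := by
    simp only [rep, dif_pos hi]
    exact hi.choose_spec
  obtain ⟨σ', H', hρ', hH', he⟩ := hrep
  refine repConj_of_induces hK hb hp hρ' hρ hH' hH fun t => ?_
  have het := congrFun he t
  exact exists_smul_eq_of_faceTriple hp (hH'.isCoherentRealisation hK hb hρ').1 hHr
    (congrArg Prod.fst het).symm (congrArg Prod.snd het).symm

/-! ### Non-degenerate faces and reversed hextets -/

/-- The triple invariant is alternating. -/
lemma exists_triple_perm (τ : Equiv.Perm (Fin 3)) : ∃ s : ℂ, s ≠ 0 ∧ ∀ X : Fin 3 → OrientedLine,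
    (X (τ 0)).triple (X (τ 1)) (X (τ 2)) = s * (X 0).triple (X 1) (X 2) := by
  have h01 : τ 0 ≠ τ 1 := by simp
  have h02 : τ 0 ≠ τ 2 := by simp
  have h12 : τ 1 ≠ τ 2 := by simp
  generalize τ 0 = i at *
  generalize τ 1 = j at *
  generalize τ 2 = k at *
  have hev : ∀ X : Fin 3 → OrientedLine, (X 1).triple (X 2) (X 0) = 1 * (X 0).triple (X 1) (X 2) ∧
      (X 2).triple (X 0) (X 1) = 1 * (X 0).triple (X 1) (X 2) := fun X => by
    rw [one_mul, ← OrientedLine.triple_rotate, OrientedLine.triple_rotate (X 2)]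
    exact ⟨rfl, rfl⟩
  have hodd : ∀ X : Fin 3 → OrientedLine,
      (X 1).triple (X 0) (X 2) = (-1) * (X 0).triple (X 1) (X 2) ∧
      (X 0).triple (X 2) (X 1) = (-1) * (X 0).triple (X 1) (X 2) ∧
      (X 2).triple (X 1) (X 0) = (-1) * (X 0).triple (X 1) (X 2) := fun X => by
    rw [neg_one_mul, ← OrientedLine.triple_swap]
    exact ⟨rfl, (OrientedLine.triple_rotate _ _ _).trans (OrientedLine.triple_rotate _ _ _),
      OrientedLine.triple_rotate _ _ _⟩
  fin_cases i <;> fin_cases j <;> fin_cases k <;> simp at h01 h02 h12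
  · exact ⟨1, one_ne_zero, fun X => (one_mul _).symm⟩
  · exact ⟨-1, by simp, fun X => (hodd X).2.1⟩
  · exact ⟨-1, by simp, fun X => (hodd X).1⟩
  · exact ⟨1, one_ne_zero, fun X => (hev X).1⟩
  · exact ⟨1, one_ne_zero, fun X => (hev X).2⟩
  · exact ⟨-1, by simp, fun X => (hodd X).2.2⟩

/-- A permutation of the four vertices matches the enumerations of the vertices of a face and of its
image up to a permutation of three letters. -/
lemma exists_perm_succAbove (π : Equiv.Perm (Fin 4)) (f : Fin 4) :
    ∃ τ : Equiv.Perm (Fin 3), ∀ i, (π f).succAbove (τ i) = π (f.succAbove i) := by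
  have h : ∀ i, ∃ j, (π f).succAbove j = π (f.succAbove i) := fun i =>
    Fin.exists_succAbove_eq (π.injective.ne (Fin.succAbove_ne f i))
  choose τ hτ using h
  have hinj : Function.Injective τ := fun i j hij =>
    Fin.succAbove_right_injective (π.injective (by rw [← hτ, ← hτ, hij]))
  exact ⟨Equiv.ofBijective τ (Finite.injective_iff_bijective.1 hinj), hτ⟩

/-- The triple invariants of a face, computed in the two adjacent tetrahedra, agree up to a sign
which does not depend on the realisation. -/
lemma exists_faceTriple_adj (t : T) (f : Fin 4) :
    ∃ s : ℂ, s ≠ 0 ∧ ∀ H : T → Fin 4 → OrientedLine, K.IsCoherentRealisation p H →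
      s * faceTriple H (K.adj t f) (K.glue t f f) = faceTriple H t f := by
  obtain ⟨τ, hτ⟩ := exists_perm_succAbove (K.glue t f) f
  obtain ⟨s, hs, h⟩ := exists_triple_perm τ
  refine ⟨s, hs, fun H hH => ?_⟩
  obtain ⟨g, hg⟩ := hH.2 t f
  have := h fun i => H (K.adj t f) ((K.glue t f f).succAbove i)
  rw [faceTriple, ← this, hτ, hτ, hτ, ← hg _ (Fin.succAbove_ne f 0), ← hg _ (Fin.succAbove_ne f 1),
    ← hg _ (Fin.succAbove_ne f 2), OrientedLine.triple_smul, faceTriple]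

lemma faceTriple_eq_of_smul {H H' : T → Fin 4 → OrientedLine} {t : T} {g : PSL(2, ℂ)}
    (h : ∀ v, g • H t v = H' t v) (f : Fin 4) : faceTriple H t f = faceTriple H' t f := by
  rw [faceTriple, faceTriple, ← h, ← h, ← h, OrientedLine.triple_smul]

/-- Hextets with the same parameters are isometric if they have the same non-zero triple invariant
on one face. -/
lemma exists_smul_eq_of_faceDet_ne_zero (hp : p ∈ K.ortholengthSpace \ K.setT)
    {H H' : T → Fin 4 → OrientedLine} (hH : K.IsRealisation p H) (hH' : K.IsRealisation p H')
    {t : T} {f : Fin 4} (hf : K.faceDet p t f ≠ 0) (h : faceTriple H t f = faceTriple H' t f) :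
    ∃ g : PSL(2, ℂ), ∀ v, g • H t v = H' t v := by
  have hc : ∀ i j, (H t i).coshDist (H t j) = (H' t i).coshDist (H' t j) := fun i j => by
    rw [← hH.hextetMatrix_apply, hH'.hextetMatrix_apply]
  have hne : (H t (f.succAbove 0)).coshDist (H t (f.succAbove 1)) ^ 2 ≠ 1 := by
    rw [hH t _ _ (Fin.succAbove_right_injective.ne (by decide))]
    exact sq_ne_one hp _
  obtain ⟨g, h0, h1⟩ := OrientedLine.exists_smul_eq_and_smul_eq hne (hc _ _)
  have h2 : g • H t (f.succAbove 2) = H' t (f.succAbove 2) := by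
    refine OrientedLine.eq_of_coshDist_of_triple (hc _ _ ▸ hne) ?_ ?_ ?_
    · rw [← h0, OrientedLine.coshDist_smul, h0, hc]
    · rw [← h1, OrientedLine.coshDist_smul, h1, hc]
    · rw [← h0, ← h1, OrientedLine.triple_smul, h0, h1]
      exact h
  have htr : faceTriple H' t f ≠ 0 := by
    intro h0
    apply hf
    have := hH'.faceTriple_sq t f
    rw [h0] at this
    simpa using this.symm
  have h3 : g • H t f = H' t f := by
    refine OrientedLine.eq_of_coshDist_of_triple_ne_zero htr ?_ ?_ ?_
    · rw [← h0, OrientedLine.coshDist_smul, h0, hc]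
    · rw [← h1, OrientedLine.coshDist_smul, h1, hc]
    · rw [← h2, OrientedLine.coshDist_smul, h2, hc]
  refine ⟨g, fun v => ?_⟩
  rcases eq_or_ne v f with rfl | hv
  · exact h3
  · obtain ⟨i, rfl⟩ := Fin.exists_succAbove_eq hv
    fin_cases i
    · exact h0
    · exact h1
    · exact h2

/-- Reversing all lines of a coherent realisation gives a coherent realisation. -/
lemma IsCoherentRealisation.neg {H : T → Fin 4 → OrientedLine}
    (hH : K.IsCoherentRealisation p H) : K.IsCoherentRealisation p fun t v => -H t v := by
  refine ⟨fun t i j h => ?_, fun t f => ?_⟩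
  · rw [OrientedLine.coshDist_neg_neg]
    exact hH.1 t i j h
  · obtain ⟨g, hg⟩ := hH.2 t f
    exact ⟨g, fun v hv => by rw [OrientedLine.smul_neg', hg v hv]⟩

/-- The dual graph of a connected triangulation is 4-regular, so it has no bridge: a non-empty set
of tetrahedra which can be left only through a single face contains all tetrahedra. -/
lemma eq_univ_of_unique_exit [Finite T] (hK : K.OneCusped) (A : Set T) (hA : A.Nonempty)
    (h : ∀ t f t' f', t ∈ A → K.adj t f ∉ A → t' ∈ A → K.adj t' f' ∉ A → (t', f') = (t, f)) :
    A = Set.univ := by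
  classical
  have := Fintype.ofFinite T
  by_contra hne
  obtain ⟨t₁, f₁, h₁, h₁'⟩ : ∃ t f, t ∈ A ∧ K.adj t f ∉ A := by
    by_contra! hcl
    apply hne
    obtain ⟨t₀, ht₀⟩ := hA
    have key : ∀ c c' : T × Fin 4, Relation.EqvGen K.CornerRel c c' → (c.1 ∈ A ↔ c'.1 ∈ A) := by
      intro c c' hcc
      induction hcc with
      | rel c c' hc =>
        obtain ⟨f, -, rfl⟩ := hc
        refine ⟨hcl _ _, fun hc' => ?_⟩
        have := hcl _ (K.glue c.1 f f) hc'
        rwa [K.adj_adj] at this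
      | refl c => exact Iff.rfl
      | symm c c' _ ih => exact ih.symm
      | trans c c' c'' _ _ ih ih' => exact ih.trans ih'
    exact Set.eq_univ_of_forall fun t => (key (t₀, 0) (t, 0) (hK _ _)).1 ht₀
  let B : Finset (T × Fin 4) := Finset.univ.filter fun c => c.1 ∈ A ∧ K.adj c.1 c.2 ∈ A
  -- the faces inside `A` are paired by the gluing
  have hB : ∑ _c ∈ B, (1 : ZMod 2) = 0 := by
    refine Finset.sum_involution (fun c _ => (K.adj c.1 c.2, K.glue c.1 c.2 c.2)) ?_ ?_ ?_ ?_
    · intro c _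
      decide
    · intro c _ _
      exact K.face_ne c.1 c.2
    · intro c hc
      simp only [B, Finset.mem_filter, Finset.mem_univ, true_and] at hc ⊢
      rw [K.adj_adj]
      exact ⟨hc.2, hc.1⟩
    · intro c _
      simp only [K.adj_adj, K.glue_adj]
      simp
  have hsplit : (Finset.univ.filter fun c : T × Fin 4 => c.1 ∈ A) = insert (t₁, f₁) B := by
    ext ⟨t, f⟩
    simp only [B, Finset.mem_filter, Finset.mem_univ, true_and, Finset.mem_insert]
    constructor
    · intro ht
      by_cases hadj : K.adj t f ∈ A
      · exact Or.inr ⟨ht, hadj⟩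
      · exact Or.inl (h t₁ f₁ t f h₁ h₁' ht hadj)
    · rintro (heq | ⟨ht, -⟩)
      · rw [Prod.mk.injEq] at heq
        rw [heq.1]
        exact h₁
      · exact ht
  -- but the number of all faces of the tetrahedra in `A` is a multiple of four
  have hcard : ∑ _c ∈ Finset.univ.filter (fun c : T × Fin 4 => c.1 ∈ A), (1 : ZMod 2) = 0 := by
    have hprod : (Finset.univ.filter fun c : T × Fin 4 => c.1 ∈ A) =
        (Finset.univ.filter fun t : T => t ∈ A) ×ˢ (Finset.univ : Finset (Fin 4)) := by
      ext ⟨t, f⟩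
      simp
    rw [hprod, Finset.sum_product]
    refine Finset.sum_eq_zero fun t _ => ?_
    decide
  rw [hsplit, Finset.sum_insert (by simp [B, h₁']), hB, add_zero] at hcard
  exact one_ne_zero hcard

/-- If at most one face of the triangulation is degenerate, then two coherent realisations are
isometric, tetrahedron by tetrahedron, up to reversing all lines of one of them. -/
theorem exists_smul_eq_or_neg [Finite T] (hK : K.OneCusped) (t₀ : T)
    (hp : p ∈ K.ortholengthSpace \ K.setT) (hS : p ∉ K.setS) {H H' : T → Fin 4 → OrientedLine}
    (hH : K.IsCoherentRealisation p H) (hH' : K.IsCoherentRealisation p H') :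
    (∀ t, ∃ g : PSL(2, ℂ), ∀ v, g • H t v = H' t v) ∨
      ∀ t, ∃ g : PSL(2, ℂ), ∀ v, g • H t v = -H' t v := by
  have huniq : ∀ t f t' f', K.faceDet p t f = 0 → K.faceDet p t' f' = 0 →
      (t', f') = (t, f) ∨ (t', f') = (K.adj t f, K.glue t f f) := by
    intro t f t' f' h h'
    by_contra! hcon
    exact hS ⟨hp.1, t, t', f, f', hcon.1, hcon.2, h, h'⟩
  have key : ∀ H' : T → Fin 4 → OrientedLine, K.IsCoherentRealisation p H' →
      ∀ f, K.faceDet p t₀ f ≠ 0 → faceTriple H t₀ f = faceTriple H' t₀ f →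
        ∀ t, ∃ g : PSL(2, ℂ), ∀ v, g • H t v = H' t v := by
    intro H' hH' f hf hft
    have hstep : ∀ t f, (∃ g : PSL(2, ℂ), ∀ v, g • H t v = H' t v) → K.faceDet p t f ≠ 0 →
        ∃ g : PSL(2, ℂ), ∀ v, g • H (K.adj t f) v = H' (K.adj t f) v := by
      rintro t f ⟨g, hg⟩ hf
      obtain ⟨s, hs, hadj⟩ := exists_faceTriple_adj (K := K) (p := p) t f
      have heq : faceTriple H (K.adj t f) (K.glue t f f) =
          faceTriple H' (K.adj t f) (K.glue t f f) :=
        mul_left_cancel₀ hs (by rw [hadj H hH, hadj H' hH', faceTriple_eq_of_smul hg])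
      refine exists_smul_eq_of_faceDet_ne_zero hp hH.1 hH'.1 (f := K.glue t f f) ?_ heq
      intro h0
      have h1 := hH.1.faceTriple_sq (K.adj t f) (K.glue t f f)
      have h2 := hH.1.faceTriple_sq t f
      rw [h0, mul_zero, sq_eq_zero_iff] at h1
      rw [← hadj H hH, h1] at h2
      exact hf (by simpa using h2.symm)
    have huniv := eq_univ_of_unique_exit hK
      {t | ∃ g : PSL(2, ℂ), ∀ v, g • H t v = H' t v}
      ⟨t₀, exists_smul_eq_of_faceDet_ne_zero hp hH.1 hH'.1 hf hft⟩ (by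
        intro t f t' f' ht hadj ht' hadj'
        have h1 : K.faceDet p t f = 0 := by_contra fun h => hadj (hstep t f ht h)
        have h2 : K.faceDet p t' f' = 0 := by_contra fun h => hadj' (hstep t' f' ht' h)
        rcases huniq t f t' f' h1 h2 with h | h
        · exact h
        · rw [Prod.mk.injEq] at h
          exact absurd (h.1 ▸ ht') hadj)
    intro t
    exact huniv.ge (Set.mem_univ t)
  -- of three faces of a tetrahedron, one is non-degenerate
  obtain ⟨f, hf⟩ : ∃ f, K.faceDet p t₀ f ≠ 0 := by
    by_contra! hall
    rcases huniq t₀ 0 t₀ 1 (hall 0) (hall 1) with h1 | h1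
    · simp at h1
    rcases huniq t₀ 0 t₀ 2 (hall 0) (hall 2) with h2 | h2
    · simp at h2
    have := h1.trans h2.symm
    simp at this
  have hsq : faceTriple H t₀ f ^ 2 = faceTriple H' t₀ f ^ 2 := by
    rw [hH.1.faceTriple_sq, hH'.1.faceTriple_sq]
  rcases sq_eq_sq_iff_eq_or_eq_neg.1 hsq with h | h
  · exact Or.inl (key H' hH' f hf h)
  · refine Or.inr (key _ hH'.neg f hf ?_)
    rw [h, faceTriple, faceTriple, OrientedLine.triple_neg_neg_neg]

/-- Representations with the same ortholengths are conjugate if at most one face is degenerate: the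
realisation with all lines reversed is induced by the same representation and the reversed line. -/
theorem repConj_of_notMem_setS [Finite T] (hK : K.OneCusped) (hb : b ∈ K.cusp)
    (hp : p ∈ K.ortholengthSpace \ K.setT) (hS : p ∉ K.setS) (hρ : HasOrtholengthsAlong ρ σ p)
    (hρ' : HasOrtholengthsAlong ρ' σ' p) : RepConj ρ ρ' := by
  obtain ⟨t₀, -⟩ := K.exists_chart_eq b
  obtain ⟨H, hH⟩ := exists_induces hK hb hρ.1
  obtain ⟨H', hH'⟩ := exists_induces hK hb hρ'.1
  rcases exists_smul_eq_or_neg hK t₀ hp hS (hH.isCoherentRealisation hK hb hρ)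
    (hH'.isCoherentRealisation hK hb hρ') with h | h
  · exact repConj_of_induces hK hb hp hρ hρ' hH hH' h
  · have hneg : Induces ρ' (-σ') fun t v => -H' t v := fun t y d => by
      obtain ⟨g, hg⟩ := hH' t y d
      exact ⟨g, fun v γ hγ => by
        rw [OrientedLine.smul_neg', OrientedLine.smul_neg', hg v γ hγ]⟩
    exact repConj_of_induces hK hb hp hρ hρ'.neg hH hneg h

end IdealTriangulation

/-! ### Holonomy of a locally constant cocycle -/

section Holonomy

open scoped Topology unitInterval

variable {X ι G : Type*} [TopologicalSpace X] [Group G] {U : ι → Set X} {c : ι → X → G}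

/-- A function `h` along the path `δ` is flat if its coordinates `c i * h` with respect to the
frames `c i` on the sets `U i` are locally constant. -/
def IsFlatAlong (U : ι → Set X) (c : ι → X → G) {x y : X} (δ : Path x y) (h : I → G) : Prop :=
  ∀ i s₀, δ s₀ ∈ U i → ∀ᶠ s in 𝓝 s₀, c i (δ s) * h s = c i (δ s₀) * h s₀

/-- If the transition functions between the frames `c i` are locally constant, then flat functions
along paths exist, and the ratio of their values at the end-points is a homomorphism from
the fundamental groupoid, acting on the left. -/
theorem exists_holonomy (hU : ∀ i, IsOpen (U i)) (hcov : ∀ x, ∃ i, x ∈ U i)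
    (hc : ∀ i j, ∀ x ∈ U i ∩ U j, ∀ᶠ y in 𝓝 x, c i y * (c j y)⁻¹ = c i x * (c j x)⁻¹) :
    ∃ hol : ∀ {x y : X}, Path.Homotopic.Quotient x y → G,
      (∀ {x y z : X} (p : Path.Homotopic.Quotient x y) (q : Path.Homotopic.Quotient y z),
        hol (p.trans q) = hol q * hol p) ∧
      ∀ {x y : X} (δ : Path x y),
        (∀ h, IsFlatAlong U c δ h → h 1 = hol (Path.Homotopic.Quotient.mk δ) * h 0) ∧
        ∃ h, IsFlatAlong U c δ h ∧ h 0 = 1 := by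
  choose idx hidx using hcov
  let : TopologicalSpace G := ⊥
  have : DiscreteTopology G := ⟨rfl⟩
  -- the covering space whose sheets over `U i` are labelled by the coordinate `c i * h`
  let Z : FiberBundleCore ι X G :=
    { baseSet := U
      isOpen_baseSet := hU
      indexAt := idx
      mem_baseSet_at := hidx
      coordChange := fun i j x v => c j x * (c i x)⁻¹ * v
      coordChange_self := fun i x _ v => by simp
      continuousOn_coordChange := fun i j => by
        rintro ⟨x, v⟩ ⟨hx, -⟩
        refine ContinuousAt.continuousWithinAt ?_
        rw [ContinuousAt, nhds_discrete G, Filter.tendsto_pure, nhds_prod_eq, nhds_discrete G]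
        filter_upwards [(hc j i x ⟨hx.2, hx.1⟩).prod_mk (Filter.mem_pure.2 rfl : {v} ∈ pure v)]
          with q hq
        rw [hq.1, hq.2]
      coordChange_comp := fun i j k x _ v => by group }
  have cov : IsCoveringMap (Bundle.TotalSpace.proj : Z.TotalSpace → X) :=
    FiberBundle.isCoveringMap
  let E : X → G → Z.TotalSpace := fun x k => ⟨x, (c (idx x) x * k : G)⟩
  let val : Z.TotalSpace → G := fun e => (c (idx e.1) e.1)⁻¹ * (id e.2 : G)
  have hval : ∀ x k, val (E x k) = k := fun x k => inv_mul_cancel_left _ _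
  have hE : ∀ e, E e.1 (val e) = e := fun e =>
    congrArg (Bundle.TotalSpace.mk e.1) (mul_inv_cancel_left (c (idx e.1) e.1) (id e.2 : G))
  have hcont : ∀ {x y : X} (δ : Path x y) (h : I → G),
      Continuous (fun s => E (δ s) (h s)) ↔ IsFlatAlong U c δ h := by
    intro x y δ h
    have hiff : ∀ i s₀, δ s₀ ∈ U i → (ContinuousAt (fun s => E (δ s) (h s)) s₀ ↔
        ∀ᶠ s in 𝓝 s₀, c i (δ s) * h s = c i (δ s₀) * h s₀) := by
      intro i s₀ hi
      have hco : ∀ s, (Z.localTriv i (E (δ s) (h s))).2 = c i (δ s) * h s := fun s => by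
        change c i (δ s) * (c (idx (δ s)) (δ s))⁻¹ * (c (idx (δ s)) (δ s) * h s) = _
        group
      rw [ContinuousAt, (Z.localTriv i).tendsto_nhds_iff
        ((Z.mem_localTriv_source i (E (δ s₀) (h s₀))).2 hi)]
      simp only [hco, nhds_discrete G, Filter.tendsto_pure]
      exact and_iff_right δ.continuous.continuousAt
    rw [continuous_iff_continuousAt]
    exact ⟨fun hΓ i s₀ hi => (hiff i s₀ hi).1 (hΓ s₀),
      fun hh s₀ => (hiff _ s₀ (hidx _)).2 (hh _ s₀ (hidx _))⟩
  have hlift : ∀ {x y : X} (δ : Path x y) (h : I → G), IsFlatAlong U c δ h →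
      (cov.monodromy (Path.Homotopic.Quotient.mk δ) ⟨E x (h 0), rfl⟩).1 = E y (h 1) := by
    intro x y δ h hh
    have h0 : E (δ 0) (h 0) = E x (h 0) := by rw [δ.source]
    have h1 : E (δ 1) (h 1) = E y (h 1) := by rw [δ.target]
    rw [← h1]
    exact congrArg (fun Γ : C(I, Z.TotalSpace) => Γ 1)
      ((cov.eq_liftPath_iff' (γ := (δ : C(I, X))) (e := E x (h 0)) δ.source
        (Γ := ⟨_, (hcont δ h).2 hh⟩)).2 ⟨rfl, h0⟩).symm
  have hex : ∀ {x y : X} (δ : Path x y) (k : G), ∃ h, IsFlatAlong U c δ h ∧ h 0 = k := by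
    intro x y δ k
    obtain ⟨Γ, hΓ, hΓ0⟩ := cov.exists_path_lifts (δ : C(I, X)) (E x k) δ.source
    have hΓs : ∀ s, E (δ s) (val (Γ s)) = Γ s := fun s => by
      rw [show δ s = (Γ s).1 from (congrFun hΓ s).symm, hE]
    refine ⟨fun s => val (Γ s), (hcont δ _).1 ?_, ?_⟩
    · simp only [hΓs]
      exact Γ.continuous
    · exact (congrArg val hΓ0).trans (hval x k)
  have hmul : ∀ {x y : X} {δ : Path x y} {h : I → G} (k : G), IsFlatAlong U c δ h →
      IsFlatAlong U c δ fun s => h s * k := fun k hh i s₀ hi => by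
    filter_upwards [hh i s₀ hi] with s hs
    rw [← mul_assoc, hs, mul_assoc]
  have hmon : ∀ {x y : X} (q : Path.Homotopic.Quotient x y) (k : G),
      (cov.monodromy q ⟨E x k, rfl⟩).1 = E y (val (cov.monodromy q ⟨E x 1, rfl⟩).1 * k) := by
    intro x y q k
    induction q using Path.Homotopic.Quotient.ind with
    | mk δ =>
      obtain ⟨h, hh, h0⟩ := hex δ 1
      have h1 := hlift δ h hh
      have h2 := hlift δ _ (hmul k hh)
      simp only [h0, one_mul] at h1 h2
      rw [h1, h2, hval]
  refine ⟨fun {x y} q => val (cov.monodromy q ⟨E x 1, rfl⟩).1, fun {x y z} p q => ?_,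
    fun {x y} δ => ⟨fun h hh => ?_, hex δ 1⟩⟩
  · beta_reduce
    have he : cov.monodromy p ⟨E x 1, rfl⟩ =
        ⟨E y (val (cov.monodromy p ⟨E x 1, rfl⟩).1), rfl⟩ :=
      Subtype.ext ((hmon p 1).trans (by rw [mul_one]))
    rw [cov.monodromy_trans_apply, he, hmon q, hval, hval]
  · have h1 := hlift δ h hh
    rw [hmon] at h1
    have := congrArg val h1
    rw [hval, hval] at this
    exact this.symm

end Holonomy

/-! ### Consistent orientations of the cells -/

namespace IdealTriangulation

open IdealTetrahedron

variable {T : Type*} (K : IdealTriangulation T)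

/-- Two cells of tetrahedra (given by their sets `S` of vertices), each with two marked vertices,
are related if they are identified by a face gluing. -/
def CellRel (q q' : T × Finset (Fin 4) × Fin 4 × Fin 4) : Prop :=
  ∃ f, f ∉ q.2.1 ∧ q' = (K.adj q.1 f, q.2.1.map (K.glue q.1 f).toEmbedding,
    K.glue q.1 f q.2.2.1, K.glue q.1 f q.2.2.2)

variable {K}

lemma CellRel.symm {q q' : T × Finset (Fin 4) × Fin 4 × Fin 4} (h : K.CellRel q q') :
    K.CellRel q' q := by
  obtain ⟨f, hf, rfl⟩ := h
  refine ⟨K.glue q.1 f f, by simpa using hf, ?_⟩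
  dsimp only
  rw [K.adj_adj, K.glue_adj]
  refine Prod.ext rfl (Prod.ext ?_ (Prod.ext (by simp) (by simp)))
  ext i
  simp [← Equiv.Perm.inv_def]

/-- Properties of a cell with two marked vertices which are preserved by the face gluings. -/
lemma eqvGen_cellRel_invariants {q q' : T × Finset (Fin 4) × Fin 4 × Fin 4}
    (h : Relation.EqvGen K.CellRel q q') :
    q.2.1.card = q'.2.1.card ∧ (q.2.2.1 ∈ q.2.1 ↔ q'.2.2.1 ∈ q'.2.1) ∧
      (q.2.2.2 ∈ q.2.1 ↔ q'.2.2.2 ∈ q'.2.1) ∧ (q.2.2.1 = q.2.2.2 ↔ q'.2.2.1 = q'.2.2.2) := by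
  induction h with
  | rel q q' h =>
    obtain ⟨f, -, rfl⟩ := h
    simp
  | refl q => simp
  | symm q q' _ ih => exact ⟨ih.1.symm, ih.2.1.symm, ih.2.2.1.symm, ih.2.2.2.symm⟩
  | trans q q' q'' _ _ ih ih' =>
    exact ⟨ih.1.trans ih'.1, ih.2.1.trans ih'.2.1, ih.2.2.1.trans ih'.2.2.1,
      ih.2.2.2.trans ih'.2.2.2⟩

lemma eqvGen_edge_of_cellRel {q q' : T × Finset (Fin 4) × Fin 4 × Fin 4}
    (h : Relation.EqvGen K.CellRel q q') (h1 : q.2.2.1 ∈ q.2.1) (h2 : q.2.2.2 ∈ q.2.1) :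
    Relation.EqvGen (fun e e' : T × Fin 4 × Fin 4 => ∃ f, f ≠ e.2.1 ∧ f ≠ e.2.2 ∧
      e' = (K.adj e.1 f, K.glue e.1 f e.2.1, K.glue e.1 f e.2.2))
      (q.1, q.2.2) (q'.1, q'.2.2) := by
  induction h with
  | rel q q' h =>
    obtain ⟨f, hf, rfl⟩ := h
    exact .rel _ _ ⟨f, ne_of_mem_of_not_mem h1 hf |>.symm, ne_of_mem_of_not_mem h2 hf |>.symm, rfl⟩
  | refl q => exact .refl _
  | symm q q' h ih =>
    have := eqvGen_cellRel_invariants h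
    exact (ih (this.2.1.2 h1) (this.2.2.1.2 h2)).symm _ _
  | trans q q' q'' h _ ih ih' =>
    have := eqvGen_cellRel_invariants h
    exact (ih h1 h2).trans _ _ _ (ih' (this.2.1.1 h1) (this.2.2.1.1 h2))

lemma eq_of_notMem_of_three_le {S : Finset (Fin 4)} (hS : 3 ≤ S.card) {f f' : Fin 4} (hf : f ∉ S)
    (hf' : f' ∉ S) : f = f' := by
  by_contra hne
  have := Finset.card_le_univ (insert f (insert f' S))
  rw [Finset.card_insert_of_notMem (by simp [hne, hf]), Finset.card_insert_of_notMem hf'] at this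
  simp at this
  omega

/-- A face or a tetrahedron is identified with at most one other cell. -/
lemma eq_or_cellRel_of_eqvGen {q q' : T × Finset (Fin 4) × Fin 4 × Fin 4}
    (h : Relation.EqvGen K.CellRel q q') (hq : 3 ≤ q.2.1.card) : q' = q ∨ K.CellRel q q' := by
  induction h with
  | rel q q' h => exact Or.inr h
  | refl q => exact Or.inl rfl
  | symm q q' h ih =>
    rcases ih ((eqvGen_cellRel_invariants h).1 ▸ hq) with h' | h'
    · exact Or.inl h'.symm
    · exact Or.inr h'.symm
  | trans q q' q'' h _ ih ih' =>
    have hq' := (eqvGen_cellRel_invariants h).1 ▸ hq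
    rcases ih hq with rfl | h1
    · exact ih' hq'
    rcases ih' hq' with rfl | h2
    · exact Or.inr h1
    obtain ⟨f, hf, rfl⟩ := h1.symm
    obtain ⟨f', hf', rfl⟩ := h2
    obtain rfl := eq_of_notMem_of_three_le hq' hf hf'
    exact Or.inl rfl

/-- No cell is identified with itself in a way which moves marked vertices. -/
lemma eq_of_eqvGen_cellRel {t : T} {S : Finset (Fin 4)} {i j i' j' : Fin 4}
    (h : Relation.EqvGen K.CellRel (t, S, i, j) (t, S, i', j')) (hS : 2 ≤ S.card) (hi : i ∈ S)
    (hj : j ∈ S) (hij : i ≠ j) : i = i' ∧ j = j' := by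
  have hinv := eqvGen_cellRel_invariants h
  have hi' := hinv.2.1.1 hi
  have hj' := hinv.2.2.1.1 hj
  have hij' := mt hinv.2.2.2.2 hij
  dsimp only at hi' hj' hij'
  rcases hS.eq_or_lt with hS | hS
  · have hpair : S = {i, j} := by
      refine (Finset.eq_of_subset_of_card_le ?_ ?_).symm
      · simp [Finset.insert_subset_iff, hi, hj]
      · rw [← hS, Finset.card_pair hij]
    rw [hpair, Finset.mem_insert, Finset.mem_singleton] at hi' hj'
    rcases hi' with rfl | rfl <;> rcases hj' with rfl | rfl
    · exact absurd rfl hij'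
    · exact ⟨rfl, rfl⟩
    · exact absurd (eqvGen_edge_of_cellRel h hi hj) (K.edge_not_reversed t _ _ hij)
    · exact absurd rfl hij'
  · rcases eq_or_cellRel_of_eqvGen h hS with h' | ⟨f, hf, h'⟩
    · simp only [Prod.mk.injEq, true_and] at h'
      exact ⟨h'.1.symm, h'.2.symm⟩
    · simp only [Prod.mk.injEq] at h'
      -- the face would be glued to itself
      have : K.glue t f f ∉ S := by
        rw [h'.2.1]
        simpa using hf
      exact absurd (Prod.ext h'.1.symm (eq_of_notMem_of_three_le hS this hf)) (K.face_ne t f)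

/-- Two distinct vertices of each cell of positive dimension can be chosen in a way compatible with
all face gluings. -/
lemma exists_orientation (K : IdealTriangulation T) : ∃ o : T → Finset (Fin 4) → Fin 4 × Fin 4,
    ∀ t S, 2 ≤ S.card → (o t S).1 ∈ S ∧ (o t S).2 ∈ S ∧ (o t S).1 ≠ (o t S).2 ∧
      ∀ f, f ∉ S → o (K.adj t f) (S.map (K.glue t f).toEmbedding) =
        (K.glue t f (o t S).1, K.glue t f (o t S).2) := by
  classical
  let r : Setoid (T × Finset (Fin 4)) :=
    { r := fun q q' => ∃ π : Equiv.Perm (Fin 4), ∀ i j,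
        Relation.EqvGen K.CellRel (q.1, q.2, i, j) (q'.1, q'.2, π i, π j)
      iseqv := ⟨fun q => ⟨1, fun i j => .refl _⟩,
        fun ⟨π, h⟩ => ⟨π⁻¹, fun i j => by simpa using (h (π⁻¹ i) (π⁻¹ j)).symm⟩,
        fun ⟨π, h⟩ ⟨π', h'⟩ => ⟨π' * π, fun i j => (h i j).trans _ _ _ (h' _ _)⟩⟩ }
  -- two vertices of one cell of each class are marked and transported to the other cells
  choose π hπ using fun q : T × Finset (Fin 4) => Quotient.mk_out (s := r) q
  have hmark : ∀ q : T × Finset (Fin 4), ∃ m : Fin 4 × Fin 4, 2 ≤ q.2.card →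
      m.1 ∈ q.2 ∧ m.2 ∈ q.2 ∧ m.1 ≠ m.2 := fun q => by
    by_cases h : 2 ≤ q.2.card
    · obtain ⟨i, j, hi, hj, hij⟩ := Finset.one_lt_card_iff.1 h
      exact ⟨(i, j), fun _ => ⟨hi, hj, hij⟩⟩
    · exact ⟨0, fun h' => absurd h' h⟩
  choose mark hmark using hmark
  let m : T × Finset (Fin 4) → Fin 4 × Fin 4 := fun q => mark (Quotient.mk r q).out
  have hm : ∀ q : T × Finset (Fin 4), 2 ≤ q.2.card →
      π q (m q).1 ∈ q.2 ∧ π q (m q).2 ∈ q.2 ∧ π q (m q).1 ≠ π q (m q).2 := fun q hq => by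
    obtain ⟨h1, h2, h3, h4⟩ := eqvGen_cellRel_invariants (hπ q (m q).1 (m q).2)
    obtain ⟨g1, g2, g3⟩ := hmark (Quotient.mk r q).out (h1.trans_ge hq)
    exact ⟨h2.1 g1, h3.1 g2, mt h4.2 g3⟩
  refine ⟨fun t S => (π (t, S) (m (t, S)).1, π (t, S) (m (t, S)).2), fun t S hS => ?_⟩
  obtain ⟨h1, h2, h3⟩ := hm (t, S) hS
  refine ⟨h1, h2, h3, fun f hf => ?_⟩
  have hrel : ∀ i j, K.CellRel (t, S, i, j) (K.adj t f, S.map (K.glue t f).toEmbedding,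
      K.glue t f i, K.glue t f j) := fun i j => ⟨f, hf, rfl⟩
  have hout : (Quotient.mk r (K.adj t f, S.map (K.glue t f).toEmbedding)).out =
      (Quotient.mk r (t, S)).out := congrArg (fun c : Quotient r => c.out)
      (Quotient.sound (s := r) ⟨K.glue t f, fun i j => .rel _ _ (hrel i j)⟩).symm
  have hq : m (K.adj t f, S.map (K.glue t f).toEmbedding) = m (t, S) := congrArg mark hout
  have hS' : 2 ≤ (S.map (K.glue t f).toEmbedding).card := card_map_le _ hS
  obtain ⟨g1, g2, g3⟩ := hm (K.adj t f, S.map (K.glue t f).toEmbedding) hS'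
  have e1 := hπ (K.adj t f, S.map (K.glue t f).toEmbedding) (m (t, S)).1 (m (t, S)).2
  rw [hout] at e1
  have e2 := (hπ (t, S) (m (t, S)).1 (m (t, S)).2).trans _ _ _ (.rel _ _ (hrel _ _))
  beta_reduce
  rw [hq] at g1 g2 g3 ⊢
  exact Prod.ext_iff.2 (eq_of_eqvGen_cellRel ((e1.symm).trans _ _ _ e2) hS' g1 g2 g3)

end IdealTriangulation

/-! ### The developing map and the holonomy of a coherent realisation -/

namespace IdealTriangulation

open IdealTetrahedron
open scoped Topology

variable {T : Type*} {K : IdealTriangulation T} {H : T → Fin 4 → OrientedLine}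
  {g : T → Fin 4 → PSL(2, ℂ)}

/-- The frames which move two lines of each tetrahedron into normal position are compatible with the
isometries `g` across the faces. -/
lemma exists_frame (hH : ∀ t i j, i ≠ j → (H t i).coshDist (H t j) ^ 2 ≠ 1)
    (hg : ∀ t f v, v ≠ f → g t f • H t v = H (K.adj t f) (K.glue t f v)) :
    ∃ B : T → Fin 4 → Fin 4 → PSL(2, ℂ), ∀ t f i j, i ≠ j → i ≠ f → j ≠ f →
      B (K.adj t f) (K.glue t f i) (K.glue t f j) * g t f = B t i j := by
  have hex : ∀ t i j, ∃ B : PSL(2, ℂ), i ≠ j → B • H t i = OrientedLine.axis ∧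
      ((B • H t j).1.1 0 0 = Complex.I * (H t i).coshDist (H t j) ∧
        (B • H t j).1.1 0 1 = 1) := fun t i j => by
    by_cases hij : i = j
    · exact ⟨1, fun h => absurd hij h⟩
    · obtain ⟨B, hB⟩ := OrientedLine.exists_normalForm _ _ (hH t i j hij)
      exact ⟨B, fun _ => hB⟩
  choose B hB using hex
  refine ⟨B, fun t f i j hij hi hj => ?_⟩
  obtain ⟨h1, h2, h3⟩ := hB t i j hij
  obtain ⟨h1', h2', h3'⟩ := hB (K.adj t f) (K.glue t f i) (K.glue t f j)
    ((K.glue t f).injective.ne hij)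
  rw [← hg t f i hi, ← mul_smul] at h1'
  rw [← hg t f i hi, ← hg t f j hj, OrientedLine.coshDist_smul, ← mul_smul] at h2'
  rw [← hg t f j hj, ← mul_smul] at h3'
  exact OrientedLine.eq_of_smul_eq (hH t i j hij) (h1'.trans h1.symm)
    (OrientedLine.eq_of_first_row (h2'.trans h2.symm) (h3'.trans h3.symm)
      (by rw [h3']; exact one_ne_zero))

/-- Frames on the stars of the cells which are constant in each tetrahedron and compatible with the
isometries `g` across the faces. -/
lemma exists_localFrame (hH : ∀ t i j, i ≠ j → (H t i).coshDist (H t j) ^ 2 ≠ 1)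
    (hg : ∀ t f v, v ≠ f → g t f • H t v = H (K.adj t f) (K.glue t f v)) :
    ∃ a : ℕ → T → IdealTetrahedron → PSL(2, ℂ),
      (∀ n t x f, K.chart t x ∈ K.stars n → x.1 f = 0 →
        a n (K.adj t f) (perm (K.glue t f) x) * g t f = a n t x) ∧
      ∀ n t x, K.chart t x ∈ K.stars n → ∀ᶠ y in 𝓝 x, a n t y = a n t x := by
  classical
  obtain ⟨B, hB⟩ := exists_frame hH hg
  obtain ⟨o, ho⟩ := exists_orientation K
  have hex : ∀ n t x, ∃ c : PSL(2, ℂ), ∀ S, InStar S x → S.card = n →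
      c = B t (o t S).1 (o t S).2 := fun n t x => by
    by_cases h : ∃ S, InStar S x ∧ S.card = n
    · obtain ⟨S, hS, hn⟩ := h
      exact ⟨B t (o t S).1 (o t S).2, fun S' hS' hn' => by rw [hS.eq hS' (hn.trans hn'.symm)]⟩
    · exact ⟨1, fun S hS hn => absurd ⟨S, hS, hn⟩ h⟩
  choose a ha using hex
  refine ⟨a, fun n t x f hx hf => ?_, fun n t x hx => ?_⟩
  · obtain ⟨S, hS, hn⟩ := K.exists_inStar_of_mem_stars hx
    obtain ⟨h1, h2, h3, h4⟩ := ho t S hS.1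
    have hfS := hS.notMem hf
    rw [ha n t x S hS hn, ha n _ _ _ (hS.perm _) (by rwa [Finset.card_map]), h4 f hfS]
    exact hB t f _ _ h3 (ne_of_mem_of_not_mem h1 hfS) (ne_of_mem_of_not_mem h2 hfS)
  · obtain ⟨S, hS, hn⟩ := K.exists_inStar_of_mem_stars hx
    filter_upwards [(isOpen_inStar S).mem_nhds hS] with y hy
    rw [ha n t x S hS hn, ha n t y S hy hn]

/-- A point close to a vertex is close to only one of them. -/
lemma eq_of_half_lt {x : IdealTetrahedron} {v w : Fin 4} (hv : 1 / 2 < x.1 v)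
    (hw : 1 / 2 < x.1 w) : v = w := by
  by_contra hne
  have h1 := Finset.sum_le_univ_sum_of_nonneg (s := {v, w}) x.2.1
  rw [Finset.sum_pair hne, x.2.2.1] at h1
  linarith

lemma exists_half_lt {t t' : T} {x x' : IdealTetrahedron} {v : Fin 4}
    (h : K.chart t x = K.chart t' x') (hv : 1 / 2 < x.1 v) : ∃ w, 1 / 2 < x'.1 w := by
  refine K.of_chart_eq (P := fun _ x' => ∃ w, 1 / 2 < x'.1 w) ?_ h ⟨v, hv⟩
  rintro t x f - ⟨w, hw⟩
  exact ⟨K.glue t f w, by rwa [perm_apply]⟩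

/-- A slight enlargement of `N` is open. -/
lemma isOpen_half_lt : IsOpen {m : K.Space | ∃ t x v, K.chart t x = m ∧ 1 / 2 < x.1 v} := by
  refine K.isOpen_of_chart fun t => ?_
  have : {x | K.chart t x ∈ {m : K.Space | ∃ t x v, K.chart t x = m ∧ 1 / 2 < x.1 v}} =
      ⋃ v, {x : IdealTetrahedron | 1 / 2 < x.1 v} := by
    ext x
    rw [Set.mem_iUnion]
    exact ⟨fun ⟨t', x', v, he, hv⟩ => exists_half_lt he hv, fun ⟨v, hv⟩ => ⟨t, x, v, rfl, hv⟩⟩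
  rw [this]
  exact isOpen_iUnion fun v => isOpen_lt continuous_const (continuous_coord v)

/-- A coherent realisation has a holonomy `hol` and developing isometries `F t x`, such that the
translates of the hextets `H t` by `F t x` are parallel along all paths inside tetrahedra, and their
lines which point to the cusp are parallel along all paths inside `N`. -/
theorem exists_developing (hH : ∀ t i j, i ≠ j → (H t i).coshDist (H t j) ^ 2 ≠ 1)
    (hg : ∀ t f v, v ≠ f → g t f • H t v = H (K.adj t f) (K.glue t f v)) :
    ∃ (hol : ∀ {m m' : K.Space}, Path.Homotopic.Quotient m m' → PSL(2, ℂ))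
      (F : T → IdealTetrahedron → PSL(2, ℂ)),
      (∀ {m m' m'' : K.Space} (q : Path.Homotopic.Quotient m m')
        (q' : Path.Homotopic.Quotient m' m''), hol (q.trans q') = hol q' * hol q) ∧
      (∀ t (x y : IdealTetrahedron) (c : Path x y),
        F t y = hol (Path.Homotopic.Quotient.mk (c.map (K.chart t).continuous)) * F t x) ∧
      ∀ t t' (x x' : IdealTetrahedron) (v v' : Fin 4) (n : Path (K.chart t x) (K.chart t' x')),
        (∀ s, n s ∈ K.cusp) → 3 / 4 ≤ x.1 v → 3 / 4 ≤ x'.1 v' →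
          F t' x' • H t' v' = hol (Path.Homotopic.Quotient.mk n) • F t x • H t v := by
  obtain ⟨a, ha, hloc⟩ := exists_localFrame hH hg
  choose τ ξ hξ using K.exists_chart_eq
  choose idx hidx using K.exists_mem_stars
  -- the frames at a point of the space are those of one of its representatives
  let c : ℕ → K.Space → PSL(2, ℂ) := fun n m => a n (τ m) (ξ m)
  have hratio : ∀ i j t x, K.chart t x ∈ K.stars i → K.chart t x ∈ K.stars j →
      c i (K.chart t x) * (c j (K.chart t x))⁻¹ = a i t x * (a j t x)⁻¹ := by
    intro i j t x hi hj
    have h := K.of_chart_eq (P := fun t' x' => K.chart t' x' ∈ K.stars i ∧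
      K.chart t' x' ∈ K.stars j ∧ a i t' x' * (a j t' x')⁻¹ = a i t x * (a j t x)⁻¹) ?_
      (hξ (K.chart t x)).symm ⟨hi, hj, rfl⟩
    · exact h.2.2
    · rintro t₁ x₁ f hf ⟨h1, h2, h3⟩
      refine ⟨K.chart_glue t₁ f x₁ hf ▸ h1, K.chart_glue t₁ f x₁ hf ▸ h2, ?_⟩
      rw [← h3, ← ha i t₁ x₁ f h1 hf, ← ha j t₁ x₁ f h2 hf]
      group
  obtain ⟨hol, htrans, hflat⟩ := exists_holonomy (U := K.stars) (c := c) K.isOpen_stars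
    K.exists_mem_stars fun i j m hm => by
      refine K.eventually_eq_of_chart (F := fun m => c i m * (c j m)⁻¹)
        ((K.isOpen_stars i).inter (K.isOpen_stars j)) (fun t x hx => ?_) hm
      have hy := (K.chart t).continuous.continuousAt.preimage_mem_nhds
        (((K.isOpen_stars i).inter (K.isOpen_stars j)).mem_nhds hx)
      filter_upwards [hy, hloc i t x hx.1, hloc j t x hx.2] with y hy h1 h2
      rw [hratio i j t y hy.1 hy.2, hratio i j t x hx.1 hx.2, h1, h2]
  let F : T → IdealTetrahedron → PSL(2, ℂ) := fun t x =>
    (c (idx (K.chart t x)) (K.chart t x))⁻¹ * a (idx (K.chart t x)) t x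
  have hF : ∀ n t x, K.chart t x ∈ K.stars n → c n (K.chart t x) * F t x = a n t x := by
    intro n t x hx
    rw [← mul_assoc, hratio n _ t x hx (hidx _)]
    group
  have hFglue : ∀ t x f, x.1 f = 0 → F (K.adj t f) (perm (K.glue t f) x) * g t f = F t x := by
    intro t x f hf
    have h1 := hidx (K.chart t x)
    have h2 := K.chart_glue t f x hf
    refine mul_left_cancel (a := c (idx (K.chart t x)) (K.chart t x)) ?_
    rw [hF _ t x h1, ← ha _ t x f h1 hf, ← hF _ _ _ (h2 ▸ h1), ← h2]
    exact (mul_assoc _ _ _).symm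
  clear_value F
  refine ⟨hol, F, htrans, fun t x y e => ?_, ?_⟩
  · have h := (hflat (e.map (K.chart t).continuous)).1 (fun s => F t (e s)) ?_
    · simpa using h
    · intro i s₀ hi
      have hU := (K.chart t).continuous.continuousAt.preimage_mem_nhds
        ((K.isOpen_stars i).mem_nhds hi)
      have h1 := e.continuous.continuousAt.eventually (hloc i t (e s₀) hi)
      have h2 := e.continuous.continuousAt.eventually hU
      filter_upwards [h1, h2] with s h1 h2
      exact (hF i t (e s) h2).trans (h1.trans (hF i t (e s₀) hi).symm)
  -- the line of the developed hextet which points to the cusp depends only on the point of `N`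
  · have hline : ∀ m, ∃ l, ∀ t x v, K.chart t x = m → 1 / 2 < x.1 v → F t x • H t v = l := by
      intro m
      by_cases hm : ∃ t x v, K.chart t x = m ∧ 1 / 2 < x.1 v
      · obtain ⟨t, x, v, rfl, hv⟩ := hm
        refine ⟨F t x • H t v, fun t' x' v' he hv' => ?_⟩
        have hP := K.of_chart_eq
          (P := fun t' x' => ∃ w, 1 / 2 < x'.1 w ∧ F t' x' • H t' w = F t x • H t v) ?_ he.symm
          ⟨v, hv, rfl⟩
        · obtain ⟨w, hw, hwe⟩ := hP
          rw [eq_of_half_lt hv' hw, hwe]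
        · rintro t₁ x₁ f hf ⟨w, hw, hwe⟩
          refine ⟨K.glue t₁ f w, by rwa [perm_apply], ?_⟩
          rw [← hwe, ← hFglue t₁ x₁ f hf, mul_smul, hg]
          rintro rfl
          rw [hf] at hw
          norm_num at hw
      · exact ⟨H (τ m) 0, fun t x v he hv => absurd ⟨t, x, v, he, hv⟩ hm⟩
    choose l hl using hline
    intro t t' x x' v v' n hn hv hv'
    obtain ⟨h, hh, h0⟩ := (hflat n).2
    have hconst : ∀ s₀, ∀ᶠ s in 𝓝 s₀, (h s)⁻¹ • l (n s) = (h s₀)⁻¹ • l (n s₀) := by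
      intro s₀
      have hi := hidx (n s₀)
      have hl' := n.continuous.continuousAt.eventually (K.eventually_eq_of_chart
        (F := fun m => c (idx (n s₀)) m • l m) ((K.isOpen_stars (idx (n s₀))).inter isOpen_half_lt)
        (fun t x hx => ?_) (m := n s₀) ⟨hi, ?_⟩)
      · filter_upwards [hh _ s₀ hi, hl'] with s h1 h2
        rw [← inv_smul_smul (c (idx (n s₀)) (n s)) (l (n s)), ← mul_smul, ← mul_inv_rev, h1, h2,
          mul_inv_rev, mul_smul, inv_smul_smul]
      · obtain ⟨hx1, t₁, x₁, v₁, he, hv₁⟩ := hx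
        obtain ⟨w, hw⟩ := exists_half_lt he hv₁
        have hU := (K.chart t).continuous.continuousAt.preimage_mem_nhds
          ((K.isOpen_stars (idx (n s₀))).mem_nhds hx1)
        filter_upwards [hU, hloc _ t x hx1,
          (isOpen_lt continuous_const (continuous_coord w)).mem_nhds hw] with y hy h1 h2
        rw [← hl _ t x w rfl hw, ← hl _ t y w rfl h2, ← mul_smul, ← mul_smul, hF _ t y hy,
          hF _ t x hx1, h1]
      · obtain ⟨t₁, x₁, v₁, hv₁, he⟩ := hn s₀
        exact ⟨t₁, x₁, v₁, he.symm, by linarith⟩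
    have hend := unitInterval.eq_of_eventually_eq hconst 1 0
    rw [h0, inv_one, one_smul, inv_smul_eq_iff, (hflat n).1 h hh, h0, mul_one, n.source,
      n.target] at hend
    rw [hl _ t x v rfl (by linarith), hl _ t' x' v' rfl (by linarith), hend]

end IdealTriangulation

/-! ### The representation of a coherent realisation -/

namespace IdealTriangulation

open IdealTetrahedron

variable {T : Type*} {K : IdealTriangulation T} {b : K.Space} {p : K.Edge → ℂ}
  {ρ : FundamentalGroup K.Space b →* PSL(2, ℂ)} {σ : OrientedLine} {H : T → Fin 4 → OrientedLine}

lemma Induces.hasOrtholengthsAlong (hI : Induces ρ σ H) (hσ : ∀ γ ∈ peripheral b, ρ γ • σ = σ)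
    (hH : K.IsRealisation p H) : HasOrtholengthsAlong ρ σ p := by
  refine ⟨hσ, fun t i j hij y d γ₁ h₁ γ₂ h₂ => ?_⟩
  obtain ⟨g, hg⟩ := hI t y d
  rw [hg i γ₁ h₁, hg j γ₂ h₂, OrientedLine.coshDist_smul, hH t i j hij]

/-- Every coherent realisation is induced by a representation, the holonomy of the developing
map. -/
theorem exists_induces_of_isCoherentRealisation (hb : b ∈ K.cusp)
    (hp : p ∈ K.ortholengthSpace \ K.setT) (hH : K.IsCoherentRealisation p H) :
    ∃ (ρ : FundamentalGroup K.Space b →* PSL(2, ℂ)) (σ : OrientedLine),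
      HasOrtholengthsAlong ρ σ p ∧ Induces ρ σ H := by
  choose g hg using hH.2
  obtain ⟨hol, F, htrans, hF, hcusp⟩ := exists_developing (K := K) (H := H) (g := g)
    (fun t i j hij => by rw [hH.1 t i j hij]; exact sq_ne_one hp _) hg
  obtain ⟨t₀, x₀, v₀, hx₀, rfl⟩ := hb
  have hone : hol (Path.Homotopic.Quotient.refl (K.chart t₀ x₀)) = 1 := by
    have := htrans (Path.Homotopic.Quotient.refl (K.chart t₀ x₀)) (Path.Homotopic.Quotient.refl _)
    rw [Path.Homotopic.Quotient.trans_refl] at this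
    exact left_eq_mul.1 this
  let ρ : FundamentalGroup K.Space (K.chart t₀ x₀) →* PSL(2, ℂ) :=
    { toFun := fun γ => hol (FundamentalGroup.toPath γ)
      map_one' := hone
      map_mul' := fun γ δ => htrans _ _ }
  have hρ : ∀ δ : Path (K.chart t₀ x₀) (K.chart t₀ x₀),
      ρ (FundamentalGroup.fromPath (Path.Homotopic.Quotient.mk δ)) =
        hol (Path.Homotopic.Quotient.mk δ) := fun δ => rfl
  have hσ : ∀ γ ∈ peripheral (K.chart t₀ x₀), ρ γ • F t₀ x₀ • H t₀ v₀ = F t₀ x₀ • H t₀ v₀ := by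
    rintro γ ⟨n, hn, rfl⟩
    rw [hρ, ← hcusp t₀ t₀ x₀ x₀ v₀ v₀ n hn hx₀ hx₀]
  have hI : Induces ρ (F t₀ x₀ • H t₀ v₀) H := fun t y d => by
    refine ⟨hol (Path.Homotopic.Quotient.mk d) * F t y, fun v γ hγ => ?_⟩
    obtain ⟨z, n, c, hz, hn, rfl⟩ := hγ
    rw [hρ, Path.Homotopic.Quotient.mk_trans, Path.Homotopic.Quotient.mk_trans, htrans, htrans,
      mul_smul, mul_smul, ← hcusp t₀ t x₀ z v₀ v n hn hx₀ hz, hF t z y c, mul_smul, mul_smul]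
  exact ⟨ρ, _, hI.hasOrtholengthsAlong hσ hH.1, hI⟩

/-- The peripheral subgroup fixes exactly the two end-points of the line it preserves, unless it
acts trivially. -/
lemma HasOrtholengthsAlong.orthEq (h : HasOrtholengthsAlong ρ σ p)
    (hne : ∃ γ ∈ peripheral b, ρ γ ≠ 1) : OrthEq ρ p := by
  refine ⟨?_, σ, h⟩
  have hncard := OrientedLine.ncard_fixed_eq_two (ρ '' peripheral b) σ
    (Set.forall_mem_image.2 h.1) (Set.exists_mem_image.2 hne)
  simp only [Set.forall_mem_image] at hncard
  exact hncard

end IdealTriangulation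

theorem lemmaL {T : Type*} [Finite T] (K : IdealTriangulation T) (hK : K.OneCusped)
    (b : K.Space) (hb : b ∈ K.cusp) (p : K.Edge → ℂ) (hp : p ∈ K.ortholengthSpace \ K.setT) :
    (∀ H : T → Fin 4 → OrientedLine, K.IsCoherentRealisation p H →
      ∃ (ρ : FundamentalGroup K.Space b →* PSL(2, ℂ)) (σ : OrientedLine),
        IdealTriangulation.HasOrtholengthsAlong ρ σ p ∧
        IdealTriangulation.Induces ρ σ H ∧
        ((∃ γ ∈ IdealTriangulation.peripheral b, ρ γ ≠ 1) → IdealTriangulation.OrthEq ρ p)) ∧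
    (∃ R : Finset (FundamentalGroup K.Space b →* PSL(2, ℂ)),
      ∀ (ρ : FundamentalGroup K.Space b →* PSL(2, ℂ)) (σ : OrientedLine),
        IdealTriangulation.HasOrtholengthsAlong ρ σ p →
        ∃ ρ' ∈ R, IdealTriangulation.RepConj ρ' ρ) ∧
    (p ∉ K.setS →
      ∀ (ρ ρ' : FundamentalGroup K.Space b →* PSL(2, ℂ)) (σ σ' : OrientedLine),
        IdealTriangulation.HasOrtholengthsAlong ρ σ p →
        IdealTriangulation.HasOrtholengthsAlong ρ' σ' p →
        IdealTriangulation.RepConj ρ ρ') := by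
  refine ⟨fun H hH => ?_, IdealTriangulation.exists_finset_repConj hK hb hp,
    fun hS ρ ρ' σ σ' h h' => IdealTriangulation.repConj_of_notMem_setS hK hb hp hS h h'⟩
  obtain ⟨ρ, σ, hρ, hI⟩ := IdealTriangulation.exists_induces_of_isCoherentRealisation hb hp hH
  exact ⟨ρ, σ, hρ, hI, hρ.orthEq⟩
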